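/- Let $0<s<1$, $T>0$, $a=1-2s$, and let $k:\mathbb R\to\mathbb R$ be measurable, bounded and $T$-periodic. Consider $Lu:=(-\partial_{xx})^s u+k(x)u$, where $(-\partial_{xx})^s$ is the Fourier multiplier with symbol $|\xi|^{2s}$. Let $L^2_T$ be the space of (a.e. classes of) real $T$-periodic functions on $\mathbb R$ that are square integrable over a period, with $\langle u,v\rangle=\int_{-T/2}^{T/2}uv\,dx$. Let $\mathcal H_T$ be the space of functions $U(x,y)$ on $\{y>0\}$ that are $T$-periodic in $x$, integrable on $(-T/2,T/2)\times(0,R)$ for every $R>0$, and have a weak gradient $\nabla U$ and a trace $U(\cdot,0)$ with $$\int_{-T/2}^{T/2}\int_0^\infty y^{a}|\nabla U|^2\,dy\,dx+\int_{-T/2}^{T/2}U(x,0)^2\,dx<\infty .$$ Here weak gradient and trace are meant in the sense of Green's formula against smooth functions on $\mathbb R^2$ that are $T$-periodic in $x$ and vanish for large $y$ (not necessarily for $y$ near $0$). For $U,V\in\mathcal H_T$ put $$B(U,V)=d_s\int_{-T/2}^{T/2}\int_0^\infty y^{a}\,\nabla U\cdot\nabla V\,dy\,dx+\int_{-T/2}^{T/2}k(x)U(x,0)V(x,0)\,dx,\qquad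 d_s=2^{2s-1}\frac{\Gamma(s)}{\Gamma(1-s)}.$$ For $g\in L^2_T$, a weak periodic solution of $Lu=g$ is a function $u\in L^2_T$ that is the trace $u=U(\cdot,0)$ of some $U\in\mathcal H_T$ with $B(U,V)=\langle g,V(\cdot,0)\rangle$ for all $V\in\mathcal H_T$. **Theorem (Fredholm alternative).** Exactly one of the following holds: (i) for each $g\in L^2_T$ there exists a unique weak periodic solution $u$ of $Lu=g$; (ii) there exists a weak periodic solution $u\not\equiv 0$ of $Lu=0$. Furthermore, the set $\mathcal N\subset L^2_T$ of weak periodic solutions of $Lu=0$ is a finite-dimensional linear subspace, and, for each $g\in L^2_T$, the equation $Lu=g$ has a weak periodic solution if and only if $\langle g,v\rangle=0$ for all $v\in\mathcal N$. -/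

import Mathlib

open MeasureTheory Set
open scoped ContDiff

namespace PeriodicFracLap

/-- One period `(-T/2, T/2]` of the line. -/
def period (T : ℝ) : Set ℝ := Ioc (-(T / 2)) (T / 2)

/-- One period `(-T/2, T/2] × (0, ∞)` of the upper half-plane. -/
def strip (T : ℝ) : Set (ℝ × ℝ) := period T ×ˢ Ioi (0 : ℝ)

/-- The space `L²_T`: (classes modulo a.e. equality of) `T`-periodic real functions on the line
that are square integrable over one period. -/
def L2T (T : ℝ) : Submodule ℝ (ℝ →ₘ[(volume : Measure ℝ)] ℝ) where
  carrier := {u | (∀ᵐ x : ℝ, u (x + T) = u x) ∧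
    MemLp (fun x : ℝ => u x) 2 (volume.restrict (period T))}
  zero_mem' := by
    have h0 : ∀ᵐ x : ℝ, (0 : ℝ →ₘ[(volume : Measure ℝ)] ℝ) x = 0 := AEEqFun.coeFn_zero
    have h1 := (measurePreserving_add_right (volume : Measure ℝ) T).quasiMeasurePreserving.ae h0
    refine ⟨?_, ?_⟩
    · filter_upwards [h0, h1] with x hx hx'
      rw [hx, hx']
    · exact (memLp_congr_ae (ae_restrict_of_ae h0)).2 (MemLp.zero' (ε := ℝ))
  add_mem' := by
    rintro u v ⟨hu, hu'⟩ ⟨hv, hv'⟩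
    have h0 : ∀ᵐ x : ℝ, (u + v) x = u x + v x := AEEqFun.coeFn_add u v
    have h1 := (measurePreserving_add_right (volume : Measure ℝ) T).quasiMeasurePreserving.ae h0
    refine ⟨?_, ?_⟩
    · filter_upwards [h0, h1, hu, hv] with x hx hx' h2 h3
      rw [hx, hx', h2, h3]
    · exact (memLp_congr_ae (ae_restrict_of_ae h0)).2 (hu'.add hv')
  smul_mem' := by
    rintro c u ⟨hu, hu'⟩
    have h0 : ∀ᵐ x : ℝ, (c • u) x = c * u x := AEEqFun.coeFn_smul c u
    have h1 := (measurePreserving_add_right (volume : Measure ℝ) T).quasiMeasurePreserving.ae h0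
    refine ⟨?_, ?_⟩
    · filter_upwards [h0, h1, hu] with x hx hx' h2
      rw [hx, hx', h2]
    · exact (memLp_congr_ae (ae_restrict_of_ae h0)).2 (hu'.const_mul c)

/-- The pairing `⟨u, v⟩ = ∫_{-T/2}^{T/2} u v dx` of `L²_T`. -/
noncomputable def pairing {T : ℝ} (u v : L2T T) : ℝ :=
  ∫ x in period T, (u : ℝ →ₘ[(volume : Measure ℝ)] ℝ) x * (v : ℝ →ₘ[(volume : Measure ℝ)] ℝ) x

/-- Test functions on the closed half-plane `y ≥ 0`: smooth, `T`-periodic in `x`, and vanishing for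
large `y` (not necessarily near `y = 0`). -/
structure IsTest (T : ℝ) (φ : ℝ × ℝ → ℝ) : Prop where
  smooth : ContDiff ℝ ∞ φ
  periodic : ∀ x y : ℝ, φ (x + T, y) = φ (x, y)
  vanishes : ∃ R : ℝ, ∀ x y : ℝ, R ≤ y → φ (x, y) = 0

/-- The space `𝓗_T` of functions `U(x, y)` on the half-plane `y > 0`, `T`-periodic in `x`, with weak
gradient `(gradX, gradY)` and trace `U(·, 0) = trace` such that
`∫∫ y^a |∇U|² dx dy + ∫ U(x,0)² dx < ∞` over one period, where `a = 1 - 2 s`.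

The weak gradient and the trace are those given by Green's formula against test functions which
need not vanish on `y = 0`; they are determined almost everywhere by `U`. -/
structure HT (s T : ℝ) where
  toFun : ℝ × ℝ → ℝ
  gradX : ℝ × ℝ → ℝ
  gradY : ℝ × ℝ → ℝ
  trace : L2T T
  periodic : ∀ x y : ℝ, toFun (x + T, y) = toFun (x, y)
  gradX_periodic : ∀ x y : ℝ, gradX (x + T, y) = gradX (x, y)
  gradY_periodic : ∀ x y : ℝ, gradY (x + T, y) = gradY (x, y)
  integrableOn : ∀ R : ℝ, IntegrableOn toFun (period T ×ˢ Ioc (0 : ℝ) R)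
  gradX_meas : AEStronglyMeasurable gradX (volume.restrict (strip T))
  gradY_meas : AEStronglyMeasurable gradY (volume.restrict (strip T))
  finite_energy :
    IntegrableOn (fun p : ℝ × ℝ => p.2 ^ (1 - 2 * s) * (gradX p ^ 2 + gradY p ^ 2)) (strip T)
  green_x : ∀ φ : ℝ × ℝ → ℝ, IsTest T φ →
    ∫ p in strip T, toFun p * fderiv ℝ φ p (1, 0) = - ∫ p in strip T, gradX p * φ p
  green_y : ∀ φ : ℝ × ℝ → ℝ, IsTest T φ →
    ∫ p in strip T, toFun p * fderiv ℝ φ p (0, 1) =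
      - (∫ p in strip T, gradY p * φ p)
        - ∫ x in period T, (trace : ℝ →ₘ[(volume : Measure ℝ)] ℝ) x * φ (x, 0)

/-- The constant `d_s = 2^(2s-1) Γ(s) / Γ(1-s)`, for which
`(-∂_xx)^s u = - d_s lim_{y ↓ 0} y^(1-2s) ∂_y U` has Fourier symbol `|ξ|^(2s)`, where `U` is the
`s`-harmonic extension of `u`. -/
noncomputable def dConst (s : ℝ) : ℝ :=
  2 ^ (2 * s - 1) * Real.Gamma s / Real.Gamma (1 - s)

/-- The bilinear form of `L = (-∂_xx)^s + k` on `𝓗_T`: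
`B(U, V) = d_s ∫∫ y^(1-2s) ∇U · ∇V dx dy + ∫ k(x) U(x,0) V(x,0) dx`. -/
noncomputable def form {s T : ℝ} (k : ℝ → ℝ) (U V : HT s T) : ℝ :=
  dConst s * (∫ p in strip T,
      p.2 ^ (1 - 2 * s) * (U.gradX p * V.gradX p + U.gradY p * V.gradY p))
    + ∫ x in period T, k x * (U.trace : ℝ →ₘ[(volume : Measure ℝ)] ℝ) x *
        (V.trace : ℝ →ₘ[(volume : Measure ℝ)] ℝ) x

/-- `u` is a weak `T`-periodic solution of `(-∂_xx)^s u + k u = g`: it is the trace of some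
`U ∈ 𝓗_T` with `B(U, V) = ⟨g, V(·, 0)⟩` for all `V ∈ 𝓗_T`. -/
def IsWeakSolution (s T : ℝ) (k : ℝ → ℝ) (g u : L2T T) : Prop :=
  ∃ U : HT s T, U.trace = u ∧ ∀ V : HT s T, form k U V = pairing g V.trace

end PeriodicFracLap

/-
Let `H` be the Hilbert space of triples `(w ∂_x U, w ∂_y U, U(·, 0))` with `w² = d_s y^(1-2s)`,
normed as a subspace of a product of `L²` spaces, let `t : H → L²` be the trace and `M` the
multiplication by `k - 1`. The equation `Lu = g` then reads `v + t† M t v = t† g`, `u = t v`, with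
`t† M t` self-adjoint, and the Fredholm alternative holds because `t` is compact.

For the compactness, test the weak gradient against `e(x) χ(y)` with a cutoff `χ` equal to `1` at
`y = 0`. This writes the trace as the sum of `-∫ χ ∂_y U dy`, of small norm if the support of `χ`
is small because `1 / w` is square integrable near `y = 0` for `s > 0`, and of a function with
derivative in `L²`, of small norm if its low Fourier coefficients vanish. So `t` is small on
subspaces of finite codimension.

In `H` the gradients are described only by orthogonality to the rotated gradients of test
functions; `U` is recovered from such a field by integrating `∂_y U` in `y` from the trace.
-/

namespace PeriodicFracLap

section CompactOperators

open Module.End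

variable {𝕜 E F : Type*} [RCLike 𝕜] [NormedAddCommGroup E] [InnerProductSpace 𝕜 E]
  [CompleteSpace E]

theorem exists_sub_smul_eq_of_mem_orthogonal_eigenspace {C : E →L[𝕜] E} (hC : IsCompactOperator C)
    (hsymm : C.IsSymmetric) {μ : 𝕜} (hμ : μ ≠ 0) {f : E}
    (hf : f ∈ (eigenspace (C : Module.End 𝕜 E) μ)ᗮ) : ∃ u : E, C u - μ • u = f := by
  set K := eigenspace (C : Module.End 𝕜 E) μ
  have hinv : ∀ w ∈ Kᗮ, (C : E →ₗ[𝕜] E) w ∈ Kᗮ :=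
    hsymm.invariant_orthogonalComplement_eigenspace μ
  let D : Kᗮ →L[𝕜] Kᗮ := C.restrict hinv
  have hD : IsCompactOperator D := hC.restrict' hinv
  have hD_eig : ¬ HasEigenvalue (D : Module.End 𝕜 Kᗮ) μ := fun h => by
    obtain ⟨w, hw, hw0⟩ := h.exists_hasEigenvector
    have hwK : (w : E) ∈ K := mem_eigenspace_iff.2 (congrArg Subtype.val (mem_eigenspace_iff.1 hw))
    exact hw0 (Subtype.ext (inner_self_eq_zero (𝕜 := 𝕜).1 (w.2 _ hwK)))
  have hbij := (hD.hasEigenvalue_or_mem_resolventSet hμ).resolve_left hD_eig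
  rw [spectrum.mem_resolventSet_iff, ContinuousLinearMap.isUnit_iff_bijective] at hbij
  obtain ⟨u, hu⟩ := hbij.2 ⟨-f, Kᗮ.neg_mem hf⟩
  refine ⟨u, ?_⟩
  have hu' : μ • (u : E) - C u = -f := congrArg Subtype.val hu
  rw [← neg_sub, hu', neg_neg]

theorem isCompactOperator_of_small_on_finite_codim [NormedAddCommGroup F] [NormedSpace 𝕜 F]
    [CompleteSpace F] (t : E →L[𝕜] F)
    (h : ∀ ε > 0, ∃ K : Submodule 𝕜 E, IsClosed (K : Set E) ∧ FiniteDimensional 𝕜 (E ⧸ K) ∧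
      ∀ u ∈ K, ‖t u‖ ≤ ε * ‖u‖) : IsCompactOperator t := by
  have hcl := isClosed_setOfPred_isCompactOperator (σ₁₂ := RingHom.id 𝕜) (M₁ := E) (M₂ := F)
  refine (hcl.closure_subset_iff.2 subset_rfl) (Metric.mem_closure_iff.2 fun ε hε => ?_)
  obtain ⟨K, hK, hcodim, hsmall⟩ := h (ε / 2) (half_pos hε)
  have : CompleteSpace K := hK.completeSpace_coe
  have : FiniteDimensional 𝕜 Kᗮ :=
    (K.quotientEquivOfIsCompl Kᗮ K.isCompl_orthogonal).finiteDimensional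
  refine ⟨t ∘L Kᗮ.starProjection, ?_, ?_⟩
  · have hfin : IsCompactOperator (t ∘L Kᗮ.subtypeL) :=
      isCompactOperator_of_locallyCompactSpace_rng _
    exact hfin.comp_clm Kᗮ.orthogonalProjectionOnto
  · refine lt_of_le_of_lt ?_ (half_lt_self hε)
    rw [dist_eq_norm]
    refine ContinuousLinearMap.opNorm_le_bound _ (half_pos hε).le fun u => ?_
    calc ‖(t - t ∘L Kᗮ.starProjection) u‖ = ‖t (K.starProjection u)‖ := by
          simp [K.starProjection_orthogonal]
      _ ≤ ε / 2 * ‖K.starProjection u‖ := hsmall _ (K.starProjection_apply_mem u)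
      _ ≤ ε / 2 * ‖u‖ := by gcongr; exact K.norm_starProjection_apply_le u

end CompactOperators

section VariationalSolution

open Module.End

variable {H L : Type*} [NormedAddCommGroup H] [InnerProductSpace ℝ H]
  [NormedAddCommGroup L] [InnerProductSpace ℝ L] {t : H →L[ℝ] L} {M : L →L[ℝ] L} {g g' f f' : L}

/-- `f` is the image under `t` of some `w` with `⟪w, v⟫ + ⟪M (t w), t v⟫ = ⟪g, t v⟫` for all `v`.
With `H` the energy space, `t` the trace and `M` a multiplication operator, this is the notion of
weak solution of a boundary problem with data `g`. -/
def IsVariationalSolution (t : H →L[ℝ] L) (M : L →L[ℝ] L) (g f : L) : Prop :=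
  ∃ w : H, t w = f ∧ ∀ v : H, inner ℝ w v + inner ℝ (M (t w)) (t v) = inner ℝ g (t v)

theorem IsVariationalSolution.sub (h : IsVariationalSolution t M g f)
    (h' : IsVariationalSolution t M g' f') : IsVariationalSolution t M (g - g') (f - f') := by
  obtain ⟨w, rfl, hw⟩ := h
  obtain ⟨w', rfl, hw'⟩ := h'
  refine ⟨w - w', map_sub t w w', fun v => ?_⟩
  rw [map_sub, map_sub, inner_sub_left, inner_sub_left, inner_sub_left, ← hw, ← hw']
  ring

variable [CompleteSpace H] [CompleteSpace L]

/-- The solutions of the homogeneous variational problem, as the image under `t` of the eigenspace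
of `t† M t` for the eigenvalue `-1`. -/
noncomputable def variationalKernel (t : H →L[ℝ] L) (M : L →L[ℝ] L) : Submodule ℝ L :=
  (eigenspace (t.adjoint ∘L M ∘L t : H →L[ℝ] H).toLinearMap (-1)).map t.toLinearMap

theorem forall_inner_add_eq_iff {w : H} :
    (∀ v : H, inner ℝ w v + inner ℝ (M (t w)) (t v) = inner ℝ g (t v)) ↔
      w + t.adjoint (M (t w)) = t.adjoint g := by
  simp_rw [← ContinuousLinearMap.adjoint_inner_left, ← inner_add_left]
  exact ⟨ext_inner_right ℝ, fun h v => by rw [h]⟩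

theorem mem_variationalKernel : f ∈ variationalKernel t M ↔ IsVariationalSolution t M 0 f := by
  simp_rw [variationalKernel, Submodule.mem_map, IsVariationalSolution, forall_inner_add_eq_iff,
    mem_eigenspace_iff, map_zero, add_eq_zero_iff_neg_eq, neg_smul, one_smul, eq_comm, and_comm]
  rfl

theorem finiteDimensional_variationalKernel (ht : IsCompactOperator t) :
    FiniteDimensional ℝ (variationalKernel t M) := by
  have hC : IsCompactOperator (t.adjoint ∘L M ∘L t : H →L[ℝ] H) := ht.clm_comp (t.adjoint ∘L M)
  have := ContinuousLinearMap.finite_dimensional_eigenspace hC (-1 : ℝ) (by norm_num)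
  exact Module.Finite.map _ _

theorem exists_isVariationalSolution_iff (ht : IsCompactOperator t) (hM : M.IsSymmetric) :
    (∃ f, IsVariationalSolution t M g f) ↔ ∀ f ∈ variationalKernel t M, inner ℝ g f = 0 := by
  constructor
  · rintro ⟨_, w, rfl, hw⟩ f hf
    obtain ⟨z, rfl, hz⟩ := mem_variationalKernel.1 hf
    rw [← hw z, hM.apply_clm, real_inner_comm, real_inner_comm (M (t z)), hz, inner_zero_left]
  · intro h
    have hsymm : (t.adjoint ∘L M ∘L t).IsSymmetric := fun u v => by
      simp only [ContinuousLinearMap.coe_coe, ContinuousLinearMap.comp_apply,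
        ContinuousLinearMap.adjoint_inner_left, ContinuousLinearMap.adjoint_inner_right,
        hM.apply_clm]
    obtain ⟨w, hw⟩ := exists_sub_smul_eq_of_mem_orthogonal_eigenspace
      (ht.clm_comp (t.adjoint ∘L M)) hsymm (μ := -1) (by norm_num) (f := t.adjoint g) <| by
        rw [Submodule.mem_orthogonal']
        intro z hz
        rw [ContinuousLinearMap.adjoint_inner_left]
        exact h _ (Submodule.mem_map_of_mem hz)
    refine ⟨t w, w, rfl, forall_inner_add_eq_iff.2 ?_⟩
    rw [← hw, neg_smul, one_smul, sub_neg_eq_add, add_comm]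
    rfl

theorem xor_existsUnique_isVariationalSolution (ht : IsCompactOperator t) (hM : M.IsSymmetric) :
    Xor (∀ g, ∃! f, IsVariationalSolution t M g f)
      (∃ f ≠ 0, IsVariationalSolution t M 0 f) := by
  have hzero : IsVariationalSolution t M 0 0 := mem_variationalKernel.1 (Submodule.zero_mem _)
  by_cases h : ∃ f ≠ 0, IsVariationalSolution t M 0 f
  · obtain ⟨f, hf0, hf⟩ := h
    exact Or.inr ⟨⟨f, hf0, hf⟩, fun hunique => hf0 ((hunique 0).unique hf hzero)⟩
  · have htriv : ∀ f, IsVariationalSolution t M 0 f → f = 0 := by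
      push Not at h
      exact fun f hf => by_contra fun hf0 => h f hf0 hf
    refine Or.inl ⟨fun g => ?_, h⟩
    obtain ⟨f, hf⟩ := (exists_isVariationalSolution_iff ht hM (g := g)).2 fun f hf => by
      rw [htriv f (mem_variationalKernel.1 hf), inner_zero_right]
    exact ⟨f, hf, fun f' hf' => sub_eq_zero.1 (htriv _ (sub_self g ▸ hf'.sub hf))⟩

theorem fredholm_alternative_of_linearEquiv {X : Type*} [AddCommGroup X] [Module ℝ X]
    {Sol : X → X → Prop} (ht : IsCompactOperator t) (hM : M.IsSymmetric) (e : X ≃ₗ[ℝ] L)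
    (hSol : ∀ g u, Sol g u ↔ IsVariationalSolution t M (e g) (e u)) :
    Xor (∀ g, ∃! u, Sol g u) (∃ u ≠ 0, Sol 0 u) ∧
      ∃ N : Submodule ℝ X, (∀ v, v ∈ N ↔ Sol 0 v) ∧ FiniteDimensional ℝ N ∧
        ∀ g, (∃ u, Sol g u) ↔ ∀ v ∈ N, inner ℝ (e g) (e v) = 0 := by
  have hfin : FiniteDimensional ℝ (variationalKernel t M) := finiteDimensional_variationalKernel ht
  refine ⟨?_, (variationalKernel t M).map e.symm.toLinearMap, fun v => ?_, inferInstance,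
    fun g => ?_⟩
  · have hxor := xor_existsUnique_isVariationalSolution ht hM
    simp only [e.surjective.forall, e.surjective.exists, e.bijective.existsUnique_iff, ne_eq,
      EmbeddingLike.map_eq_zero_iff] at hxor
    simpa only [hSol, map_zero] using hxor
  · rw [Submodule.mem_map_equiv, e.symm_symm, mem_variationalKernel, hSol, map_zero]
  · simp only [hSol, ← e.surjective.exists, exists_isVariationalSolution_iff ht hM,
      Submodule.mem_map_equiv, e.symm_symm, e.surjective.forall]

end VariationalSolution

section Period

variable {T : ℝ}

/-- The representative in the period `(-T/2, T/2]` of a real number modulo `T`. -/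
noncomputable def toPeriod (hT : 0 < T) (x : ℝ) : ℝ := toIocMod hT (-(T / 2)) x

theorem period_eq_Ioc (T : ℝ) : period T = Ioc (-(T / 2)) (-(T / 2) + T) := by
  rw [period, show -(T / 2) + T = T / 2 by ring]

theorem measurableSet_period (T : ℝ) : MeasurableSet (period T) := measurableSet_Ioc

instance isFiniteMeasure_period (T : ℝ) :
    IsFiniteMeasure ((volume : Measure ℝ).restrict (period T)) :=
  inferInstanceAs (IsFiniteMeasure ((volume : Measure ℝ).restrict (Ioc _ _)))

theorem toPeriod_add (hT : 0 < T) (x : ℝ) : toPeriod hT (x + T) = toPeriod hT x :=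
  toIocMod_add_right hT _ x

theorem toPeriod_mem (hT : 0 < T) (x : ℝ) : toPeriod hT x ∈ period T :=
  period_eq_Ioc T ▸ toIocMod_mem_Ioc hT _ x

theorem toPeriod_of_mem (hT : 0 < T) {x : ℝ} (hx : x ∈ period T) : toPeriod hT x = x :=
  (toIocMod_eq_self hT).2 (period_eq_Ioc T ▸ hx)

theorem exists_add_int_mul_eq_toPeriod (hT : 0 < T) (x : ℝ) :
    ∃ n : ℤ, x + n * T = toPeriod hT x :=
  ⟨-toIocDiv hT (-(T / 2)) x, by
    rw [toPeriod, toIocMod, zsmul_eq_mul, Int.cast_neg, neg_mul, sub_eq_add_neg]⟩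

theorem measurable_toPeriod (hT : 0 < T) : Measurable (toPeriod hT) := by
  have : Fact (0 < T) := ⟨hT⟩
  exact measurable_subtype_coe.comp
    ((AddCircle.measurableEquivIoc T (-(T / 2))).measurable.comp AddCircle.measurable_mk')

theorem ae_forall_add_int_mul {p : ℝ → Prop} (hp : ∀ᵐ x : ℝ, p x) (T : ℝ) :
    ∀ᵐ x : ℝ, ∀ n : ℤ, p (x + n * T) :=
  ae_all_iff.2 fun n =>
    (measurePreserving_add_right (volume : Measure ℝ) (n * T)).quasiMeasurePreserving.ae hp

theorem ae_toPeriod_of_ae_period (hT : 0 < T) {p : ℝ → Prop}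
    (hp : ∀ᵐ x ∂volume.restrict (period T), p x) : ∀ᵐ x : ℝ, p (toPeriod hT x) := by
  rw [ae_restrict_iff' (measurableSet_period T)] at hp
  filter_upwards [ae_forall_add_int_mul hp T] with x hx
  obtain ⟨n, hn⟩ := exists_add_int_mul_eq_toPeriod hT x
  exact hn ▸ hx n (hn ▸ toPeriod_mem hT x)

theorem ae_toPeriod_eq {E : Type*} (hT : 0 < T) {f : ℝ → E} (hf : ∀ᵐ x : ℝ, f (x + T) = f x) :
    ∀ᵐ x : ℝ, f (toPeriod hT x) = f x := by
  filter_upwards [ae_forall_add_int_mul hf T] with x hx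
  obtain ⟨n, hn⟩ := exists_add_int_mul_eq_toPeriod hT x
  have hstep : ∀ m : ℤ, f (x + (m + 1 : ℤ) * T) = f (x + m * T) := fun m => by
    rw [← hx m, Int.cast_add, Int.cast_one, add_one_mul, add_assoc]
  rw [← hn]
  clear hn
  induction n using Int.induction_on with
  | zero => simp
  | succ i ih => rw [hstep, ih]
  | pred i ih => rw [← ih, ← hstep (-(i : ℤ) - 1), sub_add_cancel]

theorem ae_eq_of_ae_eq_period {E : Type*} (hT : 0 < T) {f g : ℝ → E}
    (hf : ∀ᵐ x : ℝ, f (x + T) = f x) (hg : ∀ᵐ x : ℝ, g (x + T) = g x)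
    (h : f =ᵐ[volume.restrict (period T)] g) : f =ᵐ[volume] g := by
  filter_upwards [ae_toPeriod_eq hT hf, ae_toPeriod_eq hT hg, ae_toPeriod_of_ae_period hT h]
    with x hfx hgx hx
  rw [← hfx, hx, hgx]

theorem memLp_period_of_continuous (T : ℝ) {f : ℝ → ℝ} (hf : Continuous f) (p : ENNReal) :
    MemLp f p (volume.restrict (period T)) := by
  obtain ⟨C, hC⟩ := (isCompact_Icc (a := -(T / 2)) (b := T / 2)).exists_bound_of_continuousOn
    hf.continuousOn
  refine MemLp.of_bound hf.aestronglyMeasurable C ?_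
  filter_upwards [ae_restrict_mem (measurableSet_period T)] with x hx
  exact hC x ⟨hx.1.le, hx.2⟩

end Period

section PeriodicClasses

variable {T : ℝ}

/-- `L²` of one period, the Hilbert space model of `L2T T`. -/
abbrev L2Period (T : ℝ) : Type := Lp ℝ 2 ((volume : Measure ℝ).restrict (period T))

/-- The restriction of a periodic class to one period. -/
noncomputable def restrictPeriod (T : ℝ) : L2T T →ₗ[ℝ] L2Period T where
  toFun u := u.2.2.toLp
  map_add' u v := by
    rw [← MemLp.toLp_add]
    exact MemLp.toLp_congr _ _ (ae_restrict_of_ae (AEEqFun.coeFn_add u.1 v.1))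
  map_smul' c u := by
    rw [RingHom.id_apply, ← MemLp.toLp_const_smul]
    exact MemLp.toLp_congr _ _ (ae_restrict_of_ae (AEEqFun.coeFn_smul c u.1))

theorem coeFn_restrictPeriod (u : L2T T) :
    restrictPeriod T u =ᵐ[volume.restrict (period T)] (u : ℝ →ₘ[(volume : Measure ℝ)] ℝ) :=
  MemLp.coeFn_toLp u.2.2

theorem restrictPeriod_injective (hT : 0 < T) : Function.Injective (restrictPeriod T) := by
  intro u v huv
  refine Subtype.ext (AEEqFun.ext (ae_eq_of_ae_eq_period hT u.2.1 v.2.1 ?_))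
  exact (coeFn_restrictPeriod u).symm.trans (huv ▸ coeFn_restrictPeriod v)

theorem restrictPeriod_surjective (hT : 0 < T) : Function.Surjective (restrictPeriod T) := by
  intro f
  have hmeas : AEStronglyMeasurable (fun x => f (toPeriod hT x)) volume :=
    ((Lp.stronglyMeasurable f).comp_measurable (measurable_toPeriod hT)).aestronglyMeasurable
  have hG := AEEqFun.coeFn_mk _ hmeas
  have hGf : AEEqFun.mk _ hmeas =ᵐ[volume.restrict (period T)] f := by
    filter_upwards [ae_restrict_of_ae hG, ae_restrict_mem (measurableSet_period T)] with x hx hxT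
    rw [hx, toPeriod_of_mem hT hxT]
  have hper : ∀ᵐ x : ℝ, AEEqFun.mk _ hmeas (x + T) = AEEqFun.mk _ hmeas x := by
    filter_upwards [hG, (measurePreserving_add_right (volume : Measure ℝ)
      T).quasiMeasurePreserving.ae hG] with x hx hxT
    rw [hx, hxT, toPeriod_add]
  exact ⟨⟨_, hper, (memLp_congr_ae hGf).2 (Lp.memLp f)⟩,
    Lp.ext ((coeFn_restrictPeriod _).trans hGf)⟩

/-- The identification of `L2T T` with `L²` of one period, by restriction. -/
noncomputable def equivL2Period (hT : 0 < T) : L2T T ≃ₗ[ℝ] L2Period T :=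
  LinearEquiv.ofBijective (restrictPeriod T)
    ⟨restrictPeriod_injective hT, restrictPeriod_surjective hT⟩

theorem coeFn_equivL2Period (hT : 0 < T) (u : L2T T) : equivL2Period hT u
    =ᵐ[volume.restrict (period T)] (u : ℝ →ₘ[(volume : Measure ℝ)] ℝ) :=
  coeFn_restrictPeriod u

theorem inner_eq_integral_mul {α : Type*} [MeasurableSpace α] {μ : Measure α} (f g : Lp ℝ 2 μ) :
    inner ℝ f g = ∫ x, f x * g x ∂μ :=
  (L2.inner_def f g).trans (integral_congr_ae (.of_forall fun x => by simp [mul_comm]))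

theorem inner_toLp_eq_integral {α : Type*} [MeasurableSpace α] {μ : Measure α} (f : Lp ℝ 2 μ)
    {g : α → ℝ} (hg : MemLp g 2 μ) : inner ℝ f hg.toLp = ∫ x, f x * g x ∂μ := by
  rw [inner_eq_integral_mul]
  refine integral_congr_ae ?_
  filter_upwards [hg.coeFn_toLp] with x hx using congrArg _ hx

theorem pairing_eq_inner (hT : 0 < T) (u v : L2T T) :
    pairing u v = inner ℝ (equivL2Period hT u) (equivL2Period hT v) := by
  rw [inner_eq_integral_mul, pairing]
  refine integral_congr_ae ?_
  filter_upwards [coeFn_equivL2Period hT u, coeFn_equivL2Period hT v] with x hu hv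
  rw [hu, hv]

end PeriodicClasses

section Calculus

variable {E : Type*} [NormedAddCommGroup E] [NormedSpace ℝ E]

theorem hasDerivAt_slice_fst {φ : ℝ × ℝ → ℝ} (hφ : Differentiable ℝ φ) (x y : ℝ) :
    HasDerivAt (fun t => φ (t, y)) (fderiv ℝ φ (x, y) (1, 0)) x :=
  (hφ (x, y)).hasFDerivAt.comp_hasDerivAt x ((hasDerivAt_id x).prodMk (hasDerivAt_const x y))

theorem hasDerivAt_slice_snd {φ : ℝ × ℝ → ℝ} (hφ : Differentiable ℝ φ) (x y : ℝ) :
    HasDerivAt (fun t => φ (x, t)) (fderiv ℝ φ (x, y) (0, 1)) y :=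
  (hφ (x, y)).hasFDerivAt.comp_hasDerivAt y ((hasDerivAt_const y x).prodMk (hasDerivAt_id y))

theorem fderiv_fderiv_apply_comm {f : E → ℝ} (hf : ContDiff ℝ 2 f) (x v w : E) :
    fderiv ℝ (fun z => fderiv ℝ f z v) x w = fderiv ℝ (fun z => fderiv ℝ f z w) x v := by
  have hd : DifferentiableAt ℝ (fderiv ℝ f) x :=
    ((hf.fderiv_right (m := 1) le_rfl).differentiable one_ne_zero).differentiableAt
  have happly : ∀ u : E, fderiv ℝ (fun z => fderiv ℝ f z u) x = (fderiv ℝ (fderiv ℝ f) x).flip u :=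
    fun u => by simp [fderiv_clm_apply hd (differentiableAt_const u)]
  rw [happly, happly]
  exact (hf.contDiffAt.isSymmSndFDerivAt (by simp)).eq w v

theorem contDiff_integral_Ioi {g : E × ℝ → ℝ} (hg : ContDiff ℝ ∞ g) {a b : ℝ}
    (hg0 : ∀ x, ∀ y ∉ Icc a b, g (x, y) = 0) :
    ContDiff ℝ ∞ (fun p : E × ℝ => ∫ u in Ioi p.2, g (p.1, u)) := by
  let f : ℝ → ℝ := (Iic (0 : ℝ)).indicator fun _ => 1
  have hconv : (fun p : E × ℝ => ∫ u in Ioi p.2, g (p.1, u)) = fun p : E × ℝ =>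
      convolution f (fun y => g (p.1, y)) (ContinuousLinearMap.mul ℝ ℝ) volume p.2 := by
    funext ⟨x, y⟩
    simp only [convolution, ContinuousLinearMap.mul_apply']
    rw [← integral_sub_left_eq_self _ volume y, ← integral_Ici_eq_integral_Ioi,
      ← integral_indicator measurableSet_Ici]
    refine integral_congr_ae (.of_forall fun u => ?_)
    by_cases hu : y ≤ u <;> simp [f, indicator, hu]
  rw [hconv, ← contDiffOn_univ, ← univ_prod_univ]
  exact contDiffOn_convolution_right_with_param (n := ⊤) (ContinuousLinearMap.mul ℝ ℝ)
    isOpen_univ isCompact_Icc (fun p x _ => hg0 p x)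
    ((locallyIntegrable_const (1 : ℝ)).indicator measurableSet_Iic) hg.contDiffOn

theorem hasDerivAt_integral_Ioi [CompleteSpace E] {f : ℝ → E} (hf : Continuous f)
    (hfi : Integrable f) (y : ℝ) : HasDerivAt (fun t => ∫ u in Ioi t, f u) (-f y) y := by
  have hsplit : (fun t => ∫ u in Ioi t, f u) =
      fun t => (∫ u in Ioi 0, f u) - ∫ u in (0 : ℝ)..t, f u := by
    funext t
    rw [← intervalIntegral.integral_interval_add_Ioi (a := 0) (b := t) hfi.integrableOn
      hfi.integrableOn, add_sub_cancel_left]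
  rw [hsplit]
  exact (hf.integral_hasStrictDerivAt 0 y).hasDerivAt.const_sub _

theorem integral_primitive_mul_deriv {a b c : ℝ} {g φ : ℝ → ℝ}
    (hg : IntervalIntegrable g volume a b) (hφ : ContDiff ℝ 1 φ) :
    ∫ y in a..b, (c + ∫ t in a..y, g t) * deriv φ y =
      (c + ∫ t in a..b, g t) * φ b - c * φ a - ∫ y in a..b, g y * φ y := by
  have hF : AbsolutelyContinuousOnInterval (fun y => c + ∫ t in a..y, g t) a b :=
    (contDiff_const (n := 1)).contDiffOn.absolutelyContinuousOnInterval.add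
      (hg.absolutelyContinuousOnInterval_intervalIntegral left_mem_uIcc)
  rw [hF.integral_mul_deriv_eq_deriv_mul hφ.contDiffOn.absolutelyContinuousOnInterval,
    intervalIntegral.integral_same, add_zero]
  congr 1
  refine intervalIntegral.integral_congr_ae ?_
  filter_upwards [hg.ae_hasDerivAt_integral] with y hy hyab
  rw [((hy (uIoc_subset_uIcc hyab) a left_mem_uIcc).const_add c).deriv]

end Calculus

namespace IsTest

variable {T : ℝ} {φ : ℝ × ℝ → ℝ}

theorem continuous (h : IsTest T φ) : Continuous φ := h.smooth.continuous

theorem differentiable (h : IsTest T φ) : Differentiable ℝ φ := h.smooth.differentiable (by simp)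

theorem fderiv_apply (h : IsTest T φ) (v : ℝ × ℝ) : IsTest T (fun p => fderiv ℝ φ p v) where
  smooth := (h.smooth.fderiv_right (m := ∞) (by simp)).clm_apply contDiff_const
  periodic x y := by
    have hper : (fun p : ℝ × ℝ => φ (p + (T, 0))) = φ := by
      funext ⟨x, y⟩
      simpa using h.periodic x y
    have hshift := fderiv_comp_add_right (𝕜 := ℝ) (f := φ) (x := (x, y)) (T, 0)
    rw [hper, Prod.mk_add_mk, add_zero] at hshift
    rw [hshift]
  vanishes := by
    obtain ⟨R, hR⟩ := h.vanishes
    refine ⟨R + 1, fun x y hy => ?_⟩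
    have hzero : φ =ᶠ[nhds (x, y)] fun _ => 0 := by
      filter_upwards [(isOpen_lt continuous_const continuous_snd).mem_nhds
        (show R < (x, y).2 by dsimp only; linarith)] with p hp
      exact hR p.1 p.2 (le_of_lt hp)
    rw [hzero.fderiv_eq]
    simp

theorem exists_bound (h : IsTest T φ) :
    ∃ C R : ℝ, 0 ≤ R ∧ (∀ x y, R ≤ y → φ (x, y) = 0) ∧
      ∀ x ∈ period T, ∀ y, 0 ≤ y → |φ (x, y)| ≤ C := by
  obtain ⟨R, hR⟩ := h.vanishes
  obtain ⟨C, hC⟩ := ((isCompact_Icc (a := -(T / 2)) (b := T / 2)).prod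
    (isCompact_Icc (a := 0) (b := R))).exists_bound_of_continuousOn h.continuous.continuousOn
  refine ⟨max C 0, max R 0, le_max_right _ _, fun x y hy => hR x y ((le_max_left _ _).trans hy),
    fun x hx y hy => ?_⟩
  rcases le_total R y with hRy | hRy
  · simp [hR x y hRy]
  · exact (hC (x, y) ⟨⟨hx.1.le, hx.2⟩, ⟨hy, hRy⟩⟩).trans (le_max_left _ _)

theorem exists_primitive (h : IsTest T φ) :
    ∃ η : ℝ × ℝ → ℝ, IsTest T η ∧ ∀ x y : ℝ, 0 < y → fderiv ℝ η (x, y) (0, 1) = φ (x, y) := by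
  obtain ⟨R, hR⟩ := h.vanishes
  -- Only the values at `y > 0` matter; the cutoff makes `g` integrable in `y`.
  let g : ℝ × ℝ → ℝ := fun p => -(φ p * Real.smoothTransition (p.2 + 1))
  have hg : ContDiff ℝ ∞ g :=
    (h.smooth.mul (Real.smoothTransition.contDiff.comp (contDiff_snd.add contDiff_const))).neg
  have hg0 : ∀ x, ∀ y ∉ Icc (-1) R, g (x, y) = 0 := by
    intro x y hy
    rcases not_and_or.1 hy with hy | hy
    · simp [g, Real.smoothTransition.zero_of_nonpos (show y + 1 ≤ 0 by linarith)]
    · simp [g, hR x y (not_le.1 hy).le]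
  have hgc : ∀ x, Continuous fun y => g (x, y) := fun x =>
    hg.continuous.comp (continuous_const.prodMk continuous_id)
  have hgi : ∀ x, Integrable fun y => g (x, y) := fun x =>
    (hgc x).integrable_of_hasCompactSupport (HasCompactSupport.intro isCompact_Icc (hg0 x))
  have hη := contDiff_integral_Ioi hg hg0
  refine ⟨fun p => ∫ u in Ioi p.2, g (p.1, u), ⟨hη, fun x y => ?_, R, fun x y hy => ?_⟩,
    fun x y hy => ?_⟩
  · simp only [g, h.periodic]
  · refine setIntegral_eq_zero_of_forall_eq_zero fun u hu => ?_
    simp [g, hR x u (hy.trans (le_of_lt hu))]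
  · rw [(hasDerivAt_slice_snd (hη.differentiable (by simp)) x y).unique
      (hasDerivAt_integral_Ioi (hgc x) (hgi x) y)]
    simp [g, Real.smoothTransition.one_of_one_le (show 1 ≤ y + 1 by linarith)]

end IsTest

section Primitive

variable {α : Type*} [MeasurableSpace α]

theorem stronglyMeasurable_primitive {b : α → ℝ} (hb : StronglyMeasurable b) {g : α × ℝ → ℝ}
    (hg : StronglyMeasurable g) (a : ℝ) :
    StronglyMeasurable fun p : α × ℝ => b p.1 + ∫ t in Ioc a p.2, g (p.1, t) := by
  let F : (α × ℝ) × ℝ → ℝ := {q | a < q.2 ∧ q.2 ≤ q.1.2}.indicator fun q => g (q.1.1, q.2)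
  have hF : StronglyMeasurable F :=
    (hg.comp_measurable (by fun_prop)).indicator
      ((measurableSet_lt measurable_const measurable_snd).inter
        (measurableSet_le measurable_snd (measurable_snd.comp measurable_fst)))
  have h_integral : (fun p : α × ℝ => ∫ t in Ioc a p.2, g (p.1, t)) = fun p => ∫ t, F (p, t) := by
    funext p
    rw [← integral_indicator measurableSet_Ioc]
    rfl
  exact (hb.comp_measurable measurable_fst).add (h_integral ▸ hF.integral_prod_right')

theorem integrable_primitive {μ : Measure α} [SFinite μ] {b : α → ℝ} (hb : StronglyMeasurable b)
    (hbi : Integrable b μ) {g : α × ℝ → ℝ} (hg : StronglyMeasurable g) {a R : ℝ}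
    (hgi : Integrable g (μ.prod (volume.restrict (Ioc a R)))) :
    Integrable (fun p : α × ℝ => b p.1 + ∫ t in Ioc a p.2, g (p.1, t))
      (μ.prod (volume.restrict (Ioc a R))) := by
  have hbound : Integrable (fun x => |b x| + ∫ t in Ioc a R, ‖g (x, t)‖) μ :=
    hbi.abs.add hgi.integral_norm_prod_left
  refine (hbound.mul_prod (integrable_const (1 : ℝ))).mono'
    (stronglyMeasurable_primitive hb hg a).aestronglyMeasurable ?_
  have hle : ∀ᵐ p ∂μ.prod (volume.restrict (Ioc a R)), p.2 ∈ Ioc a R :=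
    Measure.quasiMeasurePreserving_snd.ae (ae_restrict_mem measurableSet_Ioc)
  filter_upwards [Measure.quasiMeasurePreserving_fst.ae hgi.prod_right_ae, hle] with p hp hpR
  rw [mul_one]
  refine (norm_add_le _ _).trans (add_le_add le_rfl ((norm_integral_le_integral_norm _).trans ?_))
  exact setIntegral_mono_set hp.norm (.of_forall fun t => norm_nonneg _)
    (Ioc_subset_Ioc_right hpR.2).eventuallyLE

end Primitive

section Green

variable {T : ℝ}

theorem measurableSet_strip (T : ℝ) : MeasurableSet (strip T) :=
  (measurableSet_period T).prod measurableSet_Ioi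

theorem restrict_strip (T : ℝ) : (volume : Measure (ℝ × ℝ)).restrict (strip T) =
    (volume.restrict (period T)).prod (volume.restrict (Ioi (0 : ℝ))) :=
  (Measure.prod_restrict _ _).symm

theorem measurableSet_box (T R : ℝ) : MeasurableSet (period T ×ˢ Ioc (0 : ℝ) R) :=
  (measurableSet_period T).prod measurableSet_Ioc

theorem restrict_box (T R : ℝ) : (volume : Measure (ℝ × ℝ)).restrict (period T ×ˢ Ioc 0 R) =
    (volume.restrict (period T)).prod (volume.restrict (Ioc (0 : ℝ) R)) :=
  (Measure.prod_restrict _ _).symm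

theorem box_subset_strip (T R : ℝ) : period T ×ˢ Ioc 0 R ⊆ strip T :=
  prod_mono_right Ioc_subset_Ioi_self

theorem integrableOn_mul_of_bound {R C : ℝ} {U ψ : ℝ × ℝ → ℝ}
    (hU : IntegrableOn U (period T ×ˢ Ioc 0 R)) (hψ : Continuous ψ)
    (hC : ∀ x ∈ period T, ∀ y, 0 ≤ y → |ψ (x, y)| ≤ C) :
    IntegrableOn (fun p => U p * ψ p) (period T ×ˢ Ioc 0 R) := by
  refine Integrable.mul_bdd (c := C) hU hψ.aestronglyMeasurable ?_
  filter_upwards [ae_restrict_mem (measurableSet_box T R)] with p hp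
  exact hC p.1 hp.1 p.2 hp.2.1.le

theorem setIntegral_strip_eq_box {R : ℝ} {U ψ : ℝ × ℝ → ℝ} (hR : ∀ x y, R ≤ y → ψ (x, y) = 0) :
    ∫ p in strip T, U p * ψ p = ∫ p in period T ×ˢ Ioc 0 R, U p * ψ p := by
  refine setIntegral_eq_of_subset_of_forall_sdiff_eq_zero (measurableSet_strip T)
    (box_subset_strip T R) fun p hp => ?_
  have hRp : R < p.2 := not_le.1 fun h => hp.2 ⟨hp.1.1, hp.1.2, h⟩
  rw [hR p.1 p.2 hRp.le, mul_zero]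

theorem integral_primitive_mul_deriv_of_eq_zero {R c : ℝ} {g φ : ℝ → ℝ} (hR : 0 ≤ R)
    (hg : IntegrableOn g (Ioc 0 R)) (hφ : ContDiff ℝ 1 φ) (hφR : φ R = 0) :
    ∫ y in Ioc 0 R, (c + ∫ t in Ioc 0 y, g t) * deriv φ y =
      -(∫ y in Ioc 0 R, g y * φ y) - c * φ 0 := by
  have hparts := integral_primitive_mul_deriv (c := c)
    ((intervalIntegrable_iff_integrableOn_Ioc_of_le hR).2 hg) hφ
  simp only [intervalIntegral.integral_of_le hR, hφR] at hparts
  have hcongr : ∫ y in Ioc 0 R, (c + ∫ t in Ioc 0 y, g t) * deriv φ y =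
      ∫ y in Ioc 0 R, (c + ∫ t in (0)..y, g t) * deriv φ y :=
    setIntegral_congr_fun measurableSet_Ioc fun y hy => by
      simp only [intervalIntegral.integral_of_le hy.1.le]
  rw [hcongr, hparts]
  ring

theorem IsTest.integral_primitive_mul_fderiv {φ : ℝ × ℝ → ℝ} (hφ : IsTest T φ) {b : ℝ → ℝ}
    (hb : StronglyMeasurable b) (hbi : IntegrableOn b (period T)) {g : ℝ × ℝ → ℝ}
    (hg : StronglyMeasurable g) (hgi : ∀ R, IntegrableOn g (period T ×ˢ Ioc 0 R)) :
    ∫ p in strip T, (b p.1 + ∫ t in Ioc 0 p.2, g (p.1, t)) * fderiv ℝ φ p (0, 1) =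
      -(∫ p in strip T, g p * φ p) - ∫ x in period T, b x * φ (x, 0) := by
  have hφ' := hφ.fderiv_apply (0, 1)
  obtain ⟨C, R₁, hR₁, hv, hC⟩ := hφ.exists_bound
  obtain ⟨C', R₂, -, hv', hC'⟩ := hφ'.exists_bound
  set R := max R₁ R₂
  have hR : 0 ≤ R := hR₁.trans (le_max_left _ _)
  have hgR := hgi R
  have hgφ := integrableOn_mul_of_bound hgR hφ.continuous hC
  rw [IntegrableOn, restrict_box] at hgR hgφ
  have hprim : IntegrableOn (fun p : ℝ × ℝ => b p.1 + ∫ t in Ioc 0 p.2, g (p.1, t))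
      (period T ×ˢ Ioc 0 R) := by
    rw [IntegrableOn, restrict_box]
    exact integrable_primitive hb hbi hg hgR
  have hprimφ := integrableOn_mul_of_bound hprim hφ'.continuous hC'
  have hbφ : IntegrableOn (fun x => b x * φ (x, 0)) (period T) := by
    refine Integrable.mul_bdd (c := C) hbi
      (hφ.continuous.comp (by fun_prop : Continuous fun x : ℝ => (x, (0 : ℝ)))).aestronglyMeasurable
      ?_
    filter_upwards [ae_restrict_mem (measurableSet_period T)] with x hx using hC x hx 0 le_rfl
  have hgφ' : IntegrableOn (fun x => -∫ y in Ioc 0 R, g (x, y) * φ (x, y)) (period T) :=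
    hgφ.integral_prod_left.neg
  rw [IntegrableOn, restrict_box] at hprimφ
  rw [setIntegral_strip_eq_box fun x y h => hv' x y ((le_max_right _ _).trans h),
    setIntegral_strip_eq_box fun x y h => hv x y ((le_max_left _ _).trans h),
    restrict_box, integral_prod _ hprimφ, integral_prod _ hgφ, ← integral_neg,
    ← integral_sub hgφ' hbφ]
  refine integral_congr_ae ?_
  filter_upwards [hgR.prod_right_ae] with x hx
  have hslice : ContDiff ℝ 1 fun y => φ (x, y) :=
    (hφ.smooth.of_le (by simp)).comp (contDiff_const.prodMk contDiff_id)
  have hderiv : deriv (fun y => φ (x, y)) = fun y => fderiv ℝ φ (x, y) (0, 1) :=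
    funext fun y => (hasDerivAt_slice_snd hφ.differentiable x y).deriv
  simpa only [hderiv] using
    integral_primitive_mul_deriv_of_eq_zero hR hx hslice (hv x R (le_max_left _ _))

end Green

section Gradients

variable {T : ℝ}

/-- The fields `(P, Q)` on the strip and `b` on the period satisfy the compatibility condition of a
gradient `(∂_x U, ∂_y U)` and a trace `U(·, 0)`: they annihilate `(∂_y η, -∂_x η, -∂_x η(·, 0))`
for every test function `η`. -/
def IsGradientPair (T : ℝ) (P Q : ℝ × ℝ → ℝ) (b : ℝ → ℝ) : Prop :=
  ∀ η : ℝ × ℝ → ℝ, IsTest T η →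
    (∫ p in strip T, P p * fderiv ℝ η p (0, 1)) - (∫ p in strip T, Q p * fderiv ℝ η p (1, 0)) -
      ∫ x in period T, b x * fderiv ℝ η (x, 0) (1, 0) = 0

theorem IsGradientPair.congr {P Q P' Q' : ℝ × ℝ → ℝ} {b b' : ℝ → ℝ} (h : IsGradientPair T P Q b)
    (hP : P =ᵐ[volume.restrict (strip T)] P') (hQ : Q =ᵐ[volume.restrict (strip T)] Q')
    (hb : b =ᵐ[volume.restrict (period T)] b') : IsGradientPair T P' Q' b' := by
  intro η hη
  have hPη := integral_congr_ae (hP.mul (.refl _ fun p => fderiv ℝ η p (0, 1)))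
  have hQη := integral_congr_ae (hQ.mul (.refl _ fun p => fderiv ℝ η p (1, 0)))
  have hbη := integral_congr_ae (hb.mul (.refl _ fun x => fderiv ℝ η (x, 0) (1, 0)))
  simp only [Pi.mul_apply] at hPη hQη hbη
  rw [← hPη, ← hQη, ← hbη, h η hη]

theorem HT.isGradientPair {s : ℝ} (U : HT s T) : IsGradientPair T U.gradX U.gradY
    (U.trace : ℝ →ₘ[(volume : Measure ℝ)] ℝ) := by
  intro η hη
  have hx := U.green_x _ (hη.fderiv_apply (0, 1))
  have hy := U.green_y _ (hη.fderiv_apply (1, 0))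
  simp only [fderiv_fderiv_apply_comm (contDiff_infty.1 hη.smooth 2) _ (0, 1) (1, 0)] at hx
  linarith

theorem IsTest.exists_primitive_eqOn_strip {φ : ℝ × ℝ → ℝ} (hφ : IsTest T φ) :
    ∃ η : ℝ × ℝ → ℝ, IsTest T η ∧ (∀ p ∈ strip T, fderiv ℝ η p (0, 1) = φ p) ∧
      ∀ p ∈ strip T, fderiv ℝ (fun q => fderiv ℝ η q (1, 0)) p (0, 1) = fderiv ℝ φ p (1, 0) := by
  obtain ⟨η, hη, hηφ⟩ := hφ.exists_primitive
  refine ⟨η, hη, fun p hp => hηφ p.1 p.2 hp.2, fun p hp => ?_⟩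
  have hloc : (fun q => fderiv ℝ η q (0, 1)) =ᶠ[nhds p] φ := by
    filter_upwards [(isOpen_lt continuous_const continuous_snd).mem_nhds
      (show (0 : ℝ) < p.2 from hp.2)] with q hq using hηφ q.1 q.2 hq
  rw [← hloc.fderiv_eq, fderiv_fderiv_apply_comm (contDiff_infty.1 hη.smooth 2)]

theorem IsGradientPair.integral_primitive_mul_fderiv {P Q : ℝ × ℝ → ℝ} {b : ℝ → ℝ}
    (h : IsGradientPair T P Q b) (hb : StronglyMeasurable b) (hbi : IntegrableOn b (period T))
    (hQ : StronglyMeasurable Q) (hQi : ∀ R, IntegrableOn Q (period T ×ˢ Ioc 0 R))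
    {φ : ℝ × ℝ → ℝ} (hφ : IsTest T φ) :
    ∫ p in strip T, (b p.1 + ∫ t in Ioc 0 p.2, Q (p.1, t)) * fderiv ℝ φ p (1, 0) =
      -∫ p in strip T, P p * φ p := by
  obtain ⟨η, hη, hηφ, hηφ'⟩ := hφ.exists_primitive_eqOn_strip
  have hgreen := (hη.fderiv_apply (1, 0)).integral_primitive_mul_fderiv hb hbi hQ hQi
  have hηP : ∫ p in strip T, P p * fderiv ℝ η p (0, 1) = ∫ p in strip T, P p * φ p :=
    setIntegral_congr_fun (measurableSet_strip T) fun p hp => by simp only [hηφ p hp]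
  have hηU : ∫ p in strip T, (b p.1 + ∫ t in Ioc 0 p.2, Q (p.1, t)) * fderiv ℝ φ p (1, 0) =
      ∫ p in strip T, (b p.1 + ∫ t in Ioc 0 p.2, Q (p.1, t)) *
        fderiv ℝ (fun q => fderiv ℝ η q (1, 0)) p (0, 1) :=
    setIntegral_congr_fun (measurableSet_strip T) fun p hp => by simp only [hηφ' p hp]
  rw [hηU, hgreen, ← hηP]
  linarith [h η hη]

theorem exists_HT_of_isGradientPair {s : ℝ} (hT : 0 < T) {P Q : ℝ × ℝ → ℝ} {b : L2T T}
    (h : IsGradientPair T P Q (b : ℝ →ₘ[(volume : Measure ℝ)] ℝ))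
    (hP : AEStronglyMeasurable P (volume.restrict (strip T))) (hQ : StronglyMeasurable Q)
    (hPT : ∀ x y, P (x + T, y) = P (x, y)) (hQT : ∀ x y, Q (x + T, y) = Q (x, y))
    (hQi : ∀ R, IntegrableOn Q (period T ×ˢ Ioc 0 R))
    (hE : IntegrableOn (fun p : ℝ × ℝ => p.2 ^ (1 - 2 * s) * (P p ^ 2 + Q p ^ 2)) (strip T)) :
    ∃ U : HT s T, U.gradX = P ∧ U.gradY = Q ∧ U.trace = b := by
  let f : ℝ → ℝ := fun x => (b : ℝ →ₘ[(volume : Measure ℝ)] ℝ) (toPeriod hT x)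
  have hf : StronglyMeasurable f :=
    (AEEqFun.stronglyMeasurable _).comp_measurable (measurable_toPeriod hT)
  have hfb : f =ᵐ[volume.restrict (period T)] (b : ℝ →ₘ[(volume : Measure ℝ)] ℝ) :=
    ae_restrict_of_ae (ae_toPeriod_eq hT b.2.1)
  have hfi : IntegrableOn f (period T) := (b.2.2.integrable (by norm_num)).congr hfb.symm
  refine ⟨{ toFun := fun p => f p.1 + ∫ t in Ioc 0 p.2, Q (p.1, t)
            gradX := P
            gradY := Q
            trace := b
            periodic := fun x y => by simp only [f, toPeriod_add, hQT]
            gradX_periodic := hPT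
            gradY_periodic := hQT
            integrableOn := fun R => ?_
            gradX_meas := hP
            gradY_meas := hQ.aestronglyMeasurable
            finite_energy := hE
            green_x := fun φ hφ => (h.congr .rfl .rfl
              hfb.symm).integral_primitive_mul_fderiv hf hfi hQ hQi hφ
            green_y := fun φ hφ => ?_ }, rfl, rfl, rfl⟩
  · have hQR := hQi R
    rw [IntegrableOn, restrict_box] at hQR ⊢
    exact integrable_primitive hf hfi hQ hQR
  · rw [hφ.integral_primitive_mul_fderiv hf hfi hQ hQi]
    congr 1
    exact integral_congr_ae (hfb.mul .rfl)

end Gradients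

section EnergySpace

variable {T : ℝ} {w : ℝ → ℝ}

/-- The properties of the square root `w` of a weight of Muckenhoupt type under which the energy
`∫ w(y)² |∇U|²` controls `U` up to the boundary `y = 0`. -/
structure IsEnergyWeight (w : ℝ → ℝ) : Prop where
  measurable : Measurable w
  pos : ∀ y, 0 < y → 0 < w y
  memLp_inv : ∀ R, MemLp (fun y => (w y)⁻¹) 2 (volume.restrict (Ioc 0 R))

/-- `L²` of one period of the half-plane. -/
abbrev L2Strip (T : ℝ) : Type :=
  Lp ℝ 2 (((volume : Measure ℝ).restrict (period T)).prod (volume.restrict (Ioi (0 : ℝ))))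

/-- Pairs of square integrable fields on the strip together with a square integrable trace. -/
abbrev GradientTrace (T : ℝ) : Type := WithLp 2 (L2Strip T × WithLp 2 (L2Strip T × L2Period T))

theorem IsEnergyWeight.memLp_indicator_inv (hw : IsEnergyWeight w) (R : ℝ) :
    MemLp ((Ioc 0 R).indicator fun y => (w y)⁻¹) 2 (volume.restrict (Ioi (0 : ℝ))) :=
  ((memLp_indicator_iff_restrict measurableSet_Ioc).2 (hw.memLp_inv R)).restrict _

theorem abs_div_le_mul_indicator_inv {ψ : ℝ → ℝ} {C R y : ℝ} (hy : 0 < y)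
    (hR : R ≤ y → ψ y = 0) (hC : |ψ y| ≤ C) :
    ‖ψ y / w y‖ ≤ C * ‖(Ioc 0 R).indicator (fun y => (w y)⁻¹) y‖ := by
  rcases le_or_gt R y with hRy | hRy
  · rw [hR hRy, zero_div, norm_zero]
    exact mul_nonneg ((abs_nonneg _).trans hC) (norm_nonneg _)
  · rw [indicator_of_mem (show y ∈ Ioc 0 R from ⟨hy, hRy.le⟩), div_eq_mul_inv, norm_mul]
    exact mul_le_mul_of_nonneg_right hC (norm_nonneg _)

theorem IsEnergyWeight.memLp_div_of_isTest (hw : IsEnergyWeight w) {ψ : ℝ × ℝ → ℝ}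
    (hψ : IsTest T ψ) : MemLp (fun p => ψ p / w p.2) 2
      ((volume.restrict (period T)).prod (volume.restrict (Ioi (0 : ℝ)))) := by
  obtain ⟨C, R, -, hR, hC⟩ := hψ.exists_bound
  have hmeas : Measurable fun p : ℝ × ℝ => ψ p / w p.2 :=
    hψ.continuous.measurable.div (hw.measurable.comp measurable_snd)
  refine ((hw.memLp_indicator_inv R).comp_snd (volume.restrict (period T))).of_le_mul (c := C)
    hmeas.aestronglyMeasurable ?_
  rw [← restrict_strip]
  filter_upwards [ae_restrict_mem (measurableSet_strip T)] with p hp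
  exact abs_div_le_mul_indicator_inv (ψ := fun y => ψ (p.1, y)) hp.2 (hR p.1 p.2)
    (hC p.1 hp.1 p.2 (le_of_lt hp.2))

theorem IsTest.memLp_boundary {ψ : ℝ × ℝ → ℝ} (hψ : IsTest T ψ) :
    MemLp (fun x => ψ (x, 0)) 2 (volume.restrict (period T)) :=
  memLp_period_of_continuous T
    (hψ.continuous.comp (by fun_prop : Continuous fun x : ℝ => (x, (0 : ℝ)))) 2

/-- The vector `(∂_y η / w, -∂_x η / w, -∂_x η(·, 0))` of a test function `η`; orthogonality to all
of these characterizes the triples `(w ∂_x U, w ∂_y U, U(·, 0))`. -/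
noncomputable def curlVector (hw : IsEnergyWeight w) {η : ℝ × ℝ → ℝ} (hη : IsTest T η) :
    GradientTrace T :=
  WithLp.toLp 2 ((hw.memLp_div_of_isTest (hη.fderiv_apply (0, 1))).toLp,
    WithLp.toLp 2 (-(hw.memLp_div_of_isTest (hη.fderiv_apply (1, 0))).toLp,
      -(hη.fderiv_apply (1, 0)).memLp_boundary.toLp))

theorem inner_curlVector (hw : IsEnergyWeight w) {η : ℝ × ℝ → ℝ} (hη : IsTest T η)
    (u : GradientTrace T) : inner ℝ u (curlVector hw hη) =
      (∫ p in strip T, u.fst p / w p.2 * fderiv ℝ η p (0, 1)) -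
        (∫ p in strip T, u.snd.fst p / w p.2 * fderiv ℝ η p (1, 0)) -
        ∫ x in period T, u.snd.snd x * fderiv ℝ η (x, 0) (1, 0) := by
  calc inner ℝ u (curlVector hw hη)
      = inner ℝ u.fst (hw.memLp_div_of_isTest (hη.fderiv_apply (0, 1))).toLp +
        (inner ℝ u.snd.fst (-(hw.memLp_div_of_isTest (hη.fderiv_apply (1, 0))).toLp) +
          inner ℝ u.snd.snd (-(hη.fderiv_apply (1, 0)).memLp_boundary.toLp)) := rfl
    _ = _ := by
      rw [inner_neg_right, inner_neg_right, inner_toLp_eq_integral, inner_toLp_eq_integral,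
        inner_toLp_eq_integral, restrict_strip]
      simp only [div_mul_eq_mul_div, mul_div_assoc]
      ring

/-- The Hilbert space of triples `(w ∂_x U, w ∂_y U, U(·, 0))`. -/
noncomputable def energySpace (hw : IsEnergyWeight w) (T : ℝ) : Submodule ℝ (GradientTrace T) :=
  (Submodule.span ℝ (range fun η : {η // IsTest T η} => curlVector hw η.2))ᗮ

instance (hw : IsEnergyWeight w) : CompleteSpace (energySpace hw T) :=
  (Submodule.isClosed_orthogonal _).completeSpace_coe

theorem mem_energySpace_iff (hw : IsEnergyWeight w) {u : GradientTrace T} :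
    u ∈ energySpace hw T ↔
      IsGradientPair T (fun p => u.fst p / w p.2) (fun p => u.snd.fst p / w p.2) u.snd.snd := by
  rw [energySpace, ← Submodule.span_singleton_le_iff_mem, ← Submodule.isOrtho_iff_le,
    Submodule.isOrtho_span]
  simp only [mem_singleton_iff, forall_eq, forall_mem_range, Subtype.forall, inner_curlVector,
    IsGradientPair]

end EnergySpace

section FourierSeries

variable {T : ℝ}

/-- The angular frequency `2πn / T` of the `n`-th `T`-periodic harmonic. -/
noncomputable def frequency (T : ℝ) (n : ℤ) : ℝ := 2 * Real.pi * n / T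

theorem memLp_cos_frequency (T : ℝ) (n : ℤ) :
    MemLp (fun x => Real.cos (frequency T n * x)) 2 (volume.restrict (period T)) :=
  memLp_period_of_continuous T (by fun_prop) 2

theorem memLp_sin_frequency (T : ℝ) (n : ℤ) :
    MemLp (fun x => Real.sin (frequency T n * x)) 2 (volume.restrict (period T)) :=
  memLp_period_of_continuous T (by fun_prop) 2

/-- The unnormalized Fourier coefficient `∫ f(x) exp(-2πinx / T) dx` over a period, as a continuous
real-linear functional. -/
noncomputable def fourierIntegralL (T : ℝ) (n : ℤ) : L2Period T →L[ℝ] ℂ :=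
  Complex.equivRealProdCLM.symm.toContinuousLinearMap ∘L
    ((innerSL ℝ (memLp_cos_frequency T n).toLp).prod
      (-innerSL ℝ (memLp_sin_frequency T n).toLp))

theorem fourierIntegralL_apply (n : ℤ) (f : L2Period T) : fourierIntegralL T n f =
    ⟨∫ x in period T, f x * Real.cos (frequency T n * x),
      -∫ x in period T, f x * Real.sin (frequency T n * x)⟩ := by
  rw [← inner_toLp_eq_integral f (memLp_cos_frequency T n),
    ← inner_toLp_eq_integral f (memLp_sin_frequency T n), real_inner_comm,
    real_inner_comm (MemLp.toLp _ (memLp_sin_frequency T n))]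
  rfl

theorem fourier_neg_smul_ofReal (n : ℤ) (x r : ℝ) : fourier (-n) (x : AddCircle T) • (r : ℂ) =
    ↑(r * Real.cos (frequency T n * x)) - ↑(r * Real.sin (frequency T n * x)) * Complex.I := by
  have hexp : 2 * (Real.pi : ℂ) * Complex.I * ((-n : ℤ) : ℂ) * x / T =
      ((-(frequency T n * x) : ℝ) : ℂ) * Complex.I := by
    rw [frequency]
    push_cast
    ring
  rw [fourier_coe_apply, hexp, Complex.exp_mul_I, ← Complex.ofReal_cos, ← Complex.ofReal_sin,
    Real.cos_neg, Real.sin_neg, smul_eq_mul]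
  push_cast
  ring

theorem neg_half_lt_half (hT : 0 < T) : -(T / 2) < T / 2 := by linarith

theorem fourierCoeffOn_period (hT : 0 < T) (n : ℤ) (f : L2Period T) :
    fourierCoeffOn (neg_half_lt_half hT) (fun x => (f x : ℂ)) n = T⁻¹ • fourierIntegralL T n f := by
  have hcos := (Lp.memLp f).integrable_mul (memLp_cos_frequency T n)
  have hsin := (Lp.memLp f).integrable_mul (memLp_sin_frequency T n)
  have hsplit : ∫ x in period T, fourier (-n) (x : AddCircle T) • (f x : ℂ) =
      fourierIntegralL T n f := by
    simp only [fourier_neg_smul_ofReal]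
    rw [fourierIntegralL_apply, Complex.mk_eq_add_mul_I, Complex.ofReal_neg, neg_mul,
      ← sub_eq_add_neg, ← integral_complex_ofReal, ← integral_complex_ofReal, ← integral_mul_const]
    exact integral_sub hcos.ofReal (hsin.ofReal.mul_const _)
  rw [fourierCoeffOn_eq_integral, intervalIntegral.integral_of_le (neg_half_lt_half hT).le,
    show T / 2 - -(T / 2) = T by ring, ← hsplit, one_div]
  rfl

theorem hasSum_norm_fourierIntegralL_sq (hT : 0 < T) (f : L2Period T) :
    HasSum (fun n => ‖fourierIntegralL T n f‖ ^ 2) (T * ‖f‖ ^ 2) := by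
  have hnorm : ∫ x in -(T / 2)..T / 2, ‖(f x : ℂ)‖ ^ 2 = ‖f‖ ^ 2 := by
    rw [intervalIntegral.integral_of_le (neg_half_lt_half hT).le, ← real_inner_self_eq_norm_sq,
      inner_eq_integral_mul]
    refine integral_congr_ae (.of_forall fun x => ?_)
    simp [sq]
  have hL : MemLp (fun x => (f x : ℂ)) 2 (volume.restrict (Ioc (-(T / 2)) (T / 2))) :=
    (Lp.memLp f).ofReal
  have hcoeff : ∀ n, T ^ 2 * ‖fourierCoeffOn (neg_half_lt_half hT) (fun x => (f x : ℂ)) n‖ ^ 2 =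
      ‖fourierIntegralL T n f‖ ^ 2 := fun n => by
    rw [fourierCoeffOn_period hT, norm_smul, mul_pow, norm_inv, Real.norm_of_nonneg hT.le]
    field_simp
  have hsum := (hasSum_sq_fourierCoeffOn (neg_half_lt_half hT) hL).mul_left (T ^ 2)
  simp only [hcoeff, hnorm, show T / 2 - -(T / 2) = T by ring, smul_eq_mul] at hsum
  rwa [show T ^ 2 * (T⁻¹ * ‖f‖ ^ 2) = T * ‖f‖ ^ 2 by field_simp] at hsum

/-- `q` is the derivative of `p` in the sense of distributions on the circle of length `T`. -/
def HasWeakDeriv (p q : L2Period T) : Prop :=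
  ∀ e : ℝ → ℝ, ContDiff ℝ ∞ e → Function.Periodic e T →
    ∫ x in period T, p x * deriv e x = -∫ x in period T, q x * e x

theorem fourierIntegralL_of_hasWeakDeriv (hT : T ≠ 0) {p q : L2Period T} (h : HasWeakDeriv p q)
    (n : ℤ) : fourierIntegralL T n q = frequency T n * Complex.I * fourierIntegralL T n p := by
  set θ := frequency T n with hθ
  have hper : ∀ x, θ * (x + T) = θ * x + n * (2 * Real.pi) := fun x => by
    rw [hθ, frequency]
    field_simp
  have hderiv_cos : deriv (fun x => Real.cos (θ * x)) = fun x => -θ * Real.sin (θ * x) := by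
    funext x
    simp [mul_comm]
  have hderiv_sin : deriv (fun x => Real.sin (θ * x)) = fun x => θ * Real.cos (θ * x) := by
    funext x
    simp [mul_comm]
  have hcos := h (fun x => Real.cos (θ * x)) (by fun_prop)
    fun x => by simp only [hper, Real.cos_add_int_mul_two_pi]
  have hsin := h (fun x => Real.sin (θ * x)) (by fun_prop)
    fun x => by simp only [hper, Real.sin_add_int_mul_two_pi]
  simp only [hderiv_cos, hderiv_sin, mul_left_comm (_ : ℝ) (_ : ℝ) (Real.sin _),
    mul_left_comm (_ : ℝ) θ, integral_const_mul] at hcos hsin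
  rw [fourierIntegralL_apply, fourierIntegralL_apply]
  apply Complex.ext <;>
    simp only [Complex.mul_re, Complex.mul_im, Complex.ofReal_re, Complex.ofReal_im, Complex.I_re,
      Complex.I_im] <;>
    linarith

theorem norm_sq_le_of_hasWeakDeriv_add (hT : 0 < T) {b p q : L2Period T}
    (h : HasWeakDeriv (b + p) q) {N : ℕ} (hb : ∀ n : ℤ, |n| ≤ N → fourierIntegralL T n b = 0) :
    ‖b‖ ^ 2 ≤ 2 * ‖p‖ ^ 2 + 2 * (T / (2 * Real.pi * (N + 1))) ^ 2 * ‖q‖ ^ 2 := by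
  set κ : ℝ := T / (2 * Real.pi * (N + 1)) with hκ
  have hterm : ∀ n, ‖fourierIntegralL T n b‖ ^ 2 ≤
      2 * ‖fourierIntegralL T n p‖ ^ 2 + 2 * κ ^ 2 * ‖fourierIntegralL T n q‖ ^ 2 := fun n => by
    rcases le_or_gt |n| (N : ℤ) with hn | hn
    · rw [hb n hn, norm_zero, zero_pow two_ne_zero]
      positivity
    have hfreq : 1 ≤ κ * |frequency T n| := by
      have hn' : (N : ℝ) + 1 ≤ |(n : ℝ)| := by exact_mod_cast hn
      rw [hκ, frequency, abs_div, abs_mul, abs_of_pos hT, abs_of_pos Real.two_pi_pos,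
        show T / (2 * Real.pi * (N + 1)) * (2 * Real.pi * |(n : ℝ)| / T) = |(n : ℝ)| / (N + 1) by
          field_simp]
      exact (one_le_div (by positivity)).2 hn'
    have hsum : ‖fourierIntegralL T n b + fourierIntegralL T n p‖ ≤
        κ * ‖fourierIntegralL T n q‖ := by
      rw [fourierIntegralL_of_hasWeakDeriv hT.ne' h, map_add, norm_mul, norm_mul, Complex.norm_I,
        mul_one, Complex.norm_real, Real.norm_eq_abs, ← mul_assoc]
      exact le_mul_of_one_le_left (norm_nonneg _) hfreq
    have htri : ‖fourierIntegralL T n b‖ ≤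
        ‖fourierIntegralL T n p‖ + κ * ‖fourierIntegralL T n q‖ :=
      (norm_le_add_norm_add _ (fourierIntegralL T n p)).trans (by linarith)
    calc ‖fourierIntegralL T n b‖ ^ 2
        ≤ (‖fourierIntegralL T n p‖ + κ * ‖fourierIntegralL T n q‖) ^ 2 := by gcongr
      _ ≤ 2 * (‖fourierIntegralL T n p‖ ^ 2 + (κ * ‖fourierIntegralL T n q‖) ^ 2) := add_sq_le
      _ = _ := by ring
  have hsum := hasSum_le hterm (hasSum_norm_fourierIntegralL_sq hT b)
    (((hasSum_norm_fourierIntegralL_sq hT p).mul_left 2).add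
      ((hasSum_norm_fourierIntegralL_sq hT q).mul_left (2 * κ ^ 2)))
  exact le_of_mul_le_mul_left (hsum.trans_eq (by ring)) hT

end FourierSeries

section Tensor

variable {α β : Type*} [MeasurableSpace α] [MeasurableSpace β] {μ : Measure α} {ν : Measure β}

theorem memLp_tensor {f : α → ℝ} {g : β → ℝ} (hf : MemLp f 2 μ) (hg : MemLp g 2 ν) :
    MemLp (fun p : α × β => f p.1 * g p.2) 2 (μ.prod ν) := by
  refine (memLp_two_iff_integrable_sq (hf.1.comp_fst.mul hg.1.comp_snd)).2 ?_
  simpa only [Pi.mul_apply, mul_pow] using hf.integrable_sq.mul_prod hg.integrable_sq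

theorem norm_sq_eq_integral_sq (f : Lp ℝ 2 μ) : ‖f‖ ^ 2 = ∫ x, f x ^ 2 ∂μ := by
  rw [← real_inner_self_eq_norm_sq, inner_eq_integral_mul]
  simp only [sq]

variable [SFinite μ] [SFinite ν]

theorem norm_toLp_tensor (f : Lp ℝ 2 μ) (g : Lp ℝ 2 ν) :
    ‖(memLp_tensor (Lp.memLp f) (Lp.memLp g)).toLp‖ = ‖g‖ * ‖f‖ := by
  rw [← sq_eq_sq₀ (norm_nonneg _) (by positivity), mul_pow, norm_sq_eq_integral_sq,
    norm_sq_eq_integral_sq, norm_sq_eq_integral_sq, mul_comm, ← integral_prod_mul]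
  refine integral_congr_ae ?_
  filter_upwards [(memLp_tensor (Lp.memLp f) (Lp.memLp g)).coeFn_toLp] with p hp
  rw [hp, mul_pow]

/-- The operator `f ↦ f(x) ρ(y)` of multiplication by a function of a second variable. -/
noncomputable def tensorL (μ : Measure α) [SFinite μ] (ρ : Lp ℝ 2 ν) :
    Lp ℝ 2 μ →L[ℝ] Lp ℝ 2 (μ.prod ν) :=
  LinearMap.mkContinuous
    { toFun := fun f => (memLp_tensor (Lp.memLp f) (Lp.memLp ρ)).toLp
      map_add' := fun f g => by
        rw [← MemLp.toLp_add]
        refine MemLp.toLp_congr _ _ ?_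
        filter_upwards [Measure.quasiMeasurePreserving_fst.ae (Lp.coeFn_add f g)] with p hp
        simp only [hp, Pi.add_apply, add_mul]
      map_smul' := fun c f => by
        rw [RingHom.id_apply, ← MemLp.toLp_const_smul]
        refine MemLp.toLp_congr _ _ ?_
        filter_upwards [Measure.quasiMeasurePreserving_fst.ae (Lp.coeFn_smul c f)] with p hp
        simp only [hp, Pi.smul_apply, smul_eq_mul, mul_assoc] }
    ‖ρ‖ fun f => (norm_toLp_tensor f ρ).le

/-- The operator `f ↦ ∫ f(·, y) ρ(y) dy` of weighted averaging over the second variable. -/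
noncomputable def averageL (μ : Measure α) [SFinite μ] (ρ : Lp ℝ 2 ν) :
    Lp ℝ 2 (μ.prod ν) →L[ℝ] Lp ℝ 2 μ :=
  (tensorL μ ρ).adjoint

theorem norm_averageL_apply_le (ρ : Lp ℝ 2 ν) (f : Lp ℝ 2 (μ.prod ν)) :
    ‖averageL μ ρ f‖ ≤ ‖ρ‖ * ‖f‖ := by
  refine (averageL μ ρ).le_of_opNorm_le ?_ f
  rw [averageL, LinearIsometryEquiv.norm_map]
  exact LinearMap.mkContinuous_norm_le _ (norm_nonneg _) _

theorem integral_averageL_mul {ρ : β → ℝ} (hρ : MemLp ρ 2 ν) (f : Lp ℝ 2 (μ.prod ν)) {h : α → ℝ}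
    (hh : MemLp h 2 μ) : ∫ x, averageL μ hρ.toLp f x * h x ∂μ =
      ∫ p, f p * (h p.1 * ρ p.2) ∂μ.prod ν := by
  calc ∫ x, averageL μ hρ.toLp f x * h x ∂μ
      = inner ℝ f (tensorL μ hρ.toLp hh.toLp) := by
        rw [← inner_toLp_eq_integral _ hh, averageL, ContinuousLinearMap.adjoint_inner_left]
    _ = ∫ p, f p * (hh.toLp h p.1 * hρ.toLp ρ p.2) ∂μ.prod ν :=
      inner_toLp_eq_integral _ (memLp_tensor (Lp.memLp hh.toLp) (Lp.memLp hρ.toLp))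
    _ = ∫ p, f p * (h p.1 * ρ p.2) ∂μ.prod ν := by
      refine integral_congr_ae ?_
      filter_upwards [Measure.quasiMeasurePreserving_fst.ae hh.coeFn_toLp,
        Measure.quasiMeasurePreserving_snd.ae hρ.coeFn_toLp] with p hp hp'
      rw [hp, hp']

end Tensor

section Cutoff

variable {w χ : ℝ → ℝ} {δ : ℝ}

/-- A smooth cutoff function on `y ≥ 0`, equal to one at the boundary `y = 0` and vanishing for
`y ≥ δ`; nothing is asked of it at negative `y`. -/
structure IsCutoff (δ : ℝ) (χ : ℝ → ℝ) : Prop where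
  smooth : ContDiff ℝ ∞ χ
  zero_eq_one : χ 0 = 1
  eq_zero : ∀ y, δ ≤ y → χ y = 0
  abs_le_one : ∀ y, |χ y| ≤ 1

theorem exists_isCutoff (hδ : 0 < δ) : ∃ χ, IsCutoff δ χ :=
  ⟨fun y => Real.smoothTransition (1 - y / δ),
    { smooth := Real.smoothTransition.contDiff.comp (contDiff_const.sub (contDiff_id.div_const δ))
      zero_eq_one := by simp
      eq_zero := fun y hy =>
        Real.smoothTransition.zero_of_nonpos (sub_nonpos.2 ((one_le_div hδ).2 hy))
      abs_le_one := fun y => by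
        rw [abs_of_nonneg (Real.smoothTransition.nonneg _)]
        exact Real.smoothTransition.le_one _ }⟩

theorem IsCutoff.deriv_eq_zero (hχ : IsCutoff δ χ) {y : ℝ} (hy : δ ≤ y) : deriv χ y = 0 :=
  ((hasDerivWithinAt_const y (Ici y) 0).congr (fun z hz => hχ.eq_zero z (hy.trans hz))
    (hχ.eq_zero y hy)).deriv_eq_zero (uniqueDiffOn_Ici y y self_mem_Ici)

theorem IsEnergyWeight.memLp_div_of_continuous (hw : IsEnergyWeight w) {ψ : ℝ → ℝ}
    (hψ : Continuous ψ) {R : ℝ} (hR : ∀ y, R ≤ y → ψ y = 0) :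
    MemLp (fun y => ψ y / w y) 2 (volume.restrict (Ioi (0 : ℝ))) := by
  obtain ⟨C, hC⟩ := (isCompact_Icc (a := 0) (b := R)).exists_bound_of_continuousOn hψ.continuousOn
  refine (hw.memLp_indicator_inv R).of_le_mul (c := max C 0)
    (hψ.measurable.div hw.measurable).aestronglyMeasurable ?_
  filter_upwards [ae_restrict_mem measurableSet_Ioi] with y hy
  refine abs_div_le_mul_indicator_inv hy (hR y) ?_
  rcases le_total R y with hRy | hRy
  · simp [hR y hRy]
  · exact (hC y ⟨le_of_lt hy, hRy⟩).trans (le_max_left _ _)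

theorem IsEnergyWeight.exists_isCutoff_norm_le (hw : IsEnergyWeight w) {ε : ℝ} (hε : 0 < ε) :
    ∃ δ χ, IsCutoff δ χ ∧
      ∃ h : MemLp (fun y => χ y / w y) 2 (volume.restrict (Ioi (0 : ℝ))), ‖h.toLp‖ ≤ ε := by
  obtain ⟨δ, hδ, hsmall⟩ :=
    (hw.memLp_inv 1).eLpNorm_indicator_le one_le_two ENNReal.ofNat_ne_top hε
  have hδ' : 0 < min δ 1 := lt_min hδ one_pos
  obtain ⟨χ, hχ⟩ := exists_isCutoff hδ'
  refine ⟨_, χ, hχ, hw.memLp_div_of_continuous hχ.smooth.continuous hχ.eq_zero, ?_⟩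
  rw [Lp.norm_toLp]
  refine ENNReal.toReal_le_of_le_ofReal hε.le ?_
  calc eLpNorm (fun y => χ y / w y) 2 (volume.restrict (Ioi (0 : ℝ)))
      ≤ eLpNorm ((Ioc 0 (min δ 1)).indicator fun y => (w y)⁻¹) 2 (volume.restrict (Ioi 0)) := by
        refine eLpNorm_mono_ae ?_
        filter_upwards [ae_restrict_mem measurableSet_Ioi] with y hy
        simpa only [one_mul] using
          abs_div_le_mul_indicator_inv hy (hχ.eq_zero y) (hχ.abs_le_one y)
    _ = eLpNorm ((Ioc 0 (min δ 1)).indicator fun y => (w y)⁻¹) 2 (volume.restrict (Ioc 0 1)) := by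
        rw [eLpNorm_indicator_eq_eLpNorm_restrict measurableSet_Ioc,
          eLpNorm_indicator_eq_eLpNorm_restrict measurableSet_Ioc,
          Measure.restrict_restrict_of_subset Ioc_subset_Ioi_self,
          Measure.restrict_restrict_of_subset (Ioc_subset_Ioc_right (min_le_right δ 1))]
    _ ≤ ENNReal.ofReal ε := by
        refine hsmall _ measurableSet_Ioc ((Measure.restrict_apply_le _ _).trans ?_)
        rw [Real.volume_Ioc, sub_zero]
        exact ENNReal.ofReal_le_ofReal (min_le_left _ _)

end Cutoff

section TraceOperator

variable {T δ : ℝ} {w e χ : ℝ → ℝ}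

theorem IsCutoff.isTest_mul (hχ : IsCutoff δ χ) (he : ContDiff ℝ ∞ e)
    (heT : Function.Periodic e T) : IsTest T fun p => e p.1 * χ p.2 where
  smooth := (he.comp contDiff_fst).mul (hχ.smooth.comp contDiff_snd)
  periodic x y := by rw [heT x]
  vanishes := ⟨δ, fun x y hy => by rw [hχ.eq_zero y hy, mul_zero]⟩

theorem hasWeakDeriv_trace_add_average (hw : IsEnergyWeight w) (hχ : IsCutoff δ χ)
    (hdiv : MemLp (fun y => χ y / w y) 2 (volume.restrict (Ioi (0 : ℝ))))
    (hderiv : MemLp (fun y => deriv χ y / w y) 2 (volume.restrict (Ioi (0 : ℝ))))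
    {u : GradientTrace T} (hu : u ∈ energySpace hw T) :
    HasWeakDeriv (u.snd.snd + averageL _ hdiv.toLp u.snd.fst) (-averageL _ hderiv.toLp u.fst) := by
  intro e he heT
  have hη := hχ.isTest_mul he heT
  have he' : Continuous (deriv e) := he.continuous_deriv (by simp)
  have hed : Differentiable ℝ e := he.differentiable (by simp)
  have hχd : Differentiable ℝ χ := hχ.smooth.differentiable (by simp)
  have hfst : ∀ p : ℝ × ℝ, fderiv ℝ (fun q => e q.1 * χ q.2) p (1, 0) = deriv e p.1 * χ p.2 :=
    fun p => (hasDerivAt_slice_fst hη.differentiable p.1 p.2).unique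
      ((hed p.1).hasDerivAt.mul_const (χ p.2))
  have hsnd : ∀ p : ℝ × ℝ, fderiv ℝ (fun q => e q.1 * χ q.2) p (0, 1) = e p.1 * deriv χ p.2 :=
    fun p => (hasDerivAt_slice_snd hη.differentiable p.1 p.2).unique
      ((hχd p.2).hasDerivAt.const_mul (e p.1))
  have hme := memLp_period_of_continuous T he.continuous 2
  have hme' := memLp_period_of_continuous T he' 2
  have hgrad := (mem_energySpace_iff hw).1 hu _ hη
  simp only [hfst, hsnd, hχ.zero_eq_one, mul_one, restrict_strip, div_mul_eq_mul_div,
    mul_div_assoc] at hgrad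
  rw [← integral_averageL_mul hderiv _ hme, ← integral_averageL_mul hdiv _ hme'] at hgrad
  rw [← inner_toLp_eq_integral _ hme, ← inner_toLp_eq_integral _ hme', inner_neg_left,
    inner_add_left, inner_toLp_eq_integral, inner_toLp_eq_integral, inner_toLp_eq_integral]
  linarith

/-- The trace `U ↦ U(·, 0)` on the energy space. -/
noncomputable def traceL (hw : IsEnergyWeight w) (T : ℝ) : energySpace hw T →L[ℝ] L2Period T :=
  WithLp.sndL 2 ℝ _ _ ∘L WithLp.sndL 2 ℝ _ _ ∘L (energySpace hw T).subtypeL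

theorem norm_sq_gradientTrace (u : GradientTrace T) :
    ‖u‖ ^ 2 = ‖u.fst‖ ^ 2 + (‖u.snd.fst‖ ^ 2 + ‖u.snd.snd‖ ^ 2) := by
  rw [WithLp.prod_norm_sq_eq_of_L2, WithLp.prod_norm_sq_eq_of_L2]

theorem exists_large_frequency (T B : ℝ) {ε : ℝ} (hε : 0 < ε) :
    ∃ N : ℕ, 2 * (T / (2 * Real.pi * (N + 1))) ^ 2 * B ≤ ε := by
  have hlim : Filter.Tendsto (fun N : ℕ => 2 * (T / (2 * Real.pi) * (1 / ((N : ℝ) + 1))) ^ 2 * B)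
      Filter.atTop (nhds (2 * (T / (2 * Real.pi) * 0) ^ 2 * B)) :=
    (((tendsto_one_div_add_atTop_nhds_zero_nat.const_mul _).pow 2).const_mul _).mul_const _
  rw [mul_zero, zero_pow two_ne_zero, mul_zero, zero_mul] at hlim
  obtain ⟨N, hN⟩ := (hlim.eventually_le_const hε).exists
  exact ⟨N, by rwa [div_mul_div_comm, mul_one] at hN⟩

theorem exists_norm_traceL_le (hw : IsEnergyWeight w) (hT : 0 < T) {ε : ℝ} (hε : 0 < ε) :
    ∃ N : ℕ, ∀ u : energySpace hw T,
      (∀ n : ℤ, |n| ≤ N → fourierIntegralL T n (traceL hw T u) = 0) →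
        ‖traceL hw T u‖ ≤ ε * ‖u‖ := by
  obtain ⟨δ, χ, hχ, hdiv, hsmall⟩ := hw.exists_isCutoff_norm_le (half_pos hε)
  have hderiv := hw.memLp_div_of_continuous (hχ.smooth.continuous_deriv (by simp))
    fun y => hχ.deriv_eq_zero
  obtain ⟨N, hN⟩ := exists_large_frequency T (‖hderiv.toLp‖ ^ 2) (show 0 < ε ^ 2 / 2 by positivity)
  refine ⟨N, fun u hu => ?_⟩
  have hle := norm_sq_le_of_hasWeakDeriv_add hT
    (hasWeakDeriv_trace_add_average hw hχ hdiv hderiv u.2) hu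
  rw [norm_neg] at hle
  rw [← sq_le_sq₀ (norm_nonneg _) (by positivity), mul_pow]
  set κ := (T / (2 * Real.pi * (N + 1))) ^ 2
  calc ‖traceL hw T u‖ ^ 2
      ≤ 2 * (‖hdiv.toLp‖ * ‖u.1.snd.fst‖) ^ 2 + 2 * κ * (‖hderiv.toLp‖ * ‖u.1.fst‖) ^ 2 := by
        refine hle.trans ?_
        gcongr <;> exact norm_averageL_apply_le _ _
    _ = 2 * ‖hdiv.toLp‖ ^ 2 * ‖u.1.snd.fst‖ ^ 2 +
          2 * κ * ‖hderiv.toLp‖ ^ 2 * ‖u.1.fst‖ ^ 2 := by ring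
    _ ≤ 2 * (ε / 2) ^ 2 * ‖u.1.snd.fst‖ ^ 2 + ε ^ 2 / 2 * ‖u.1.fst‖ ^ 2 := by gcongr
    _ ≤ ε ^ 2 * ‖u.1‖ ^ 2 := by
        rw [norm_sq_gradientTrace]
        nlinarith [sq_nonneg (ε * ‖u.1.fst‖), sq_nonneg (ε * ‖u.1.snd.fst‖),
          sq_nonneg (ε * ‖u.1.snd.snd‖)]

theorem isCompactOperator_traceL (hw : IsEnergyWeight w) (hT : 0 < T) :
    IsCompactOperator (traceL hw T) := by
  refine isCompactOperator_of_small_on_finite_codim (𝕜 := ℝ) (E := energySpace hw T)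
    (F := L2Period T) (traceL hw T) fun ε hε => ?_
  obtain ⟨N, hN⟩ := exists_norm_traceL_le hw hT hε
  let lowFrequencies : energySpace hw T →L[ℝ] (Icc (-(N : ℤ)) N → ℂ) :=
    ContinuousLinearMap.pi fun n => fourierIntegralL T n ∘L traceL hw T
  refine ⟨lowFrequencies.ker, lowFrequencies.isClosed_ker,
    lowFrequencies.toLinearMap.quotKerEquivRange.symm.finiteDimensional, fun u hu => ?_⟩
  exact hN u fun n hn => congrFun (LinearMap.mem_ker.1 hu) ⟨n, abs_le.1 hn⟩

end TraceOperator

section Multiplier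

variable {α : Type*} [MeasurableSpace α] {μ : Measure α} {c : α → ℝ}

/-- Multiplication by an essentially bounded function, as an operator on `L²`. -/
noncomputable def mulL (hc : MemLp c ⊤ μ) : Lp ℝ 2 μ →L[ℝ] Lp ℝ 2 μ :=
  (ContinuousLinearMap.mul ℝ ℝ).holderL μ ⊤ 2 2 hc.toLp

theorem coeFn_mulL (hc : MemLp c ⊤ μ) (f : Lp ℝ 2 μ) : mulL hc f =ᵐ[μ] fun x => c x * f x := by
  filter_upwards [(ContinuousLinearMap.mul ℝ ℝ).coeFn_holder (r := 2) hc.toLp f, hc.coeFn_toLp]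
    with x hf hx
  rw [← hx]
  exact hf

theorem inner_mulL (hc : MemLp c ⊤ μ) (f g : Lp ℝ 2 μ) :
    inner ℝ (mulL hc f) g = ∫ x, c x * f x * g x ∂μ := by
  rw [inner_eq_integral_mul]
  refine integral_congr_ae ?_
  filter_upwards [coeFn_mulL hc f] with x hx using congrArg (· * g x) hx

theorem isSymmetric_mulL (hc : MemLp c ⊤ μ) : (mulL hc).IsSymmetric := fun f g => by
  rw [ContinuousLinearMap.coe_coe, inner_mulL, real_inner_comm, inner_mulL]
  congr 1 with x
  ring

end Multiplier

section Weight

variable {s : ℝ}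

theorem dConst_pos (hs0 : 0 < s) (hs1 : s < 1) : 0 < dConst s :=
  div_pos (mul_pos (Real.rpow_pos_of_pos two_pos _) (Real.Gamma_pos_of_pos hs0))
    (Real.Gamma_pos_of_pos (sub_pos.2 hs1))

/-- The square root of the weight `d_s y^(1-2s)` of the energy, so that the energy of `U` is the
square of the `L²` norm of `weight s y • ∇U`. -/
noncomputable def weight (s y : ℝ) : ℝ := √(dConst s * y ^ (1 - 2 * s))

theorem weight_sq (hs0 : 0 < s) (hs1 : s < 1) {y : ℝ} (hy : 0 < y) :
    weight s y ^ 2 = dConst s * y ^ (1 - 2 * s) :=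
  Real.sq_sqrt (mul_pos (dConst_pos hs0 hs1) (Real.rpow_pos_of_pos hy _)).le

theorem isEnergyWeight_weight (hs0 : 0 < s) (hs1 : s < 1) : IsEnergyWeight (weight s) where
  measurable := ((measurable_id.pow_const _).const_mul _).sqrt
  pos y hy := Real.sqrt_pos.2 (mul_pos (dConst_pos hs0 hs1) (Real.rpow_pos_of_pos hy _))
  memLp_inv R := by
    have hmeas : Measurable (weight s) := ((measurable_id.pow_const _).const_mul _).sqrt
    refine (memLp_two_iff_integrable_sq hmeas.inv.aestronglyMeasurable).2 ?_
    have h_integrable : IntegrableOn (fun y : ℝ => (dConst s)⁻¹ * y ^ (2 * s - 1)) (Ioc 0 R) := by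
      rcases le_total R 0 with hR | hR
      · rw [Ioc_eq_empty_of_le hR]
        exact integrableOn_empty
      · rw [← intervalIntegrable_iff_integrableOn_Ioc_of_le hR]
        exact (intervalIntegral.intervalIntegrable_rpow' (by linarith)).const_mul _
    refine h_integrable.congr_fun (fun y hy => ?_) measurableSet_Ioc
    simp only [Pi.inv_apply, inv_pow]
    rw [weight_sq hs0 hs1 hy.1, mul_inv, ← Real.rpow_neg hy.1.le, neg_sub]

end Weight

section Unweight

variable {T : ℝ} {w : ℝ → ℝ}

/-- The field `f / w` on the strip, extended periodically to the half-plane. -/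
noncomputable def unweight (hT : 0 < T) (w : ℝ → ℝ) (f : ℝ × ℝ → ℝ) (p : ℝ × ℝ) : ℝ :=
  f (toPeriod hT p.1, p.2) / w p.2

theorem unweight_add (hT : 0 < T) (f : ℝ × ℝ → ℝ) (x y : ℝ) :
    unweight hT w f (x + T, y) = unweight hT w f (x, y) := by
  simp only [unweight, toPeriod_add]

theorem unweight_of_mem_strip (hT : 0 < T) (f : ℝ × ℝ → ℝ) {p : ℝ × ℝ} (hp : p ∈ strip T) :
    unweight hT w f p = f p / w p.2 := by
  rw [unweight, toPeriod_of_mem hT hp.1]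

theorem unweight_ae_eq (hT : 0 < T) (w : ℝ → ℝ) (f : ℝ × ℝ → ℝ) :
    unweight hT w f =ᵐ[volume.restrict (strip T)] fun p => f p / w p.2 :=
  (ae_restrict_iff' (measurableSet_strip T)).2 (.of_forall fun _ => unweight_of_mem_strip hT f)

theorem stronglyMeasurable_unweight (hT : 0 < T) (hw : Measurable w) {f : ℝ × ℝ → ℝ}
    (hf : StronglyMeasurable f) : StronglyMeasurable (unweight hT w f) :=
  (hf.comp_measurable (((measurable_toPeriod hT).comp measurable_fst).prodMk measurable_snd)).div
    (hw.comp measurable_snd).stronglyMeasurable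

theorem integrableOn_unweight (hT : 0 < T) (hw : IsEnergyWeight w) (f : L2Strip T) (R : ℝ) :
    IntegrableOn (unweight hT w f) (period T ×ˢ Ioc 0 R) := by
  have hf : MemLp f 2 (volume.restrict (period T ×ˢ Ioc 0 R)) := by
    refine (Lp.memLp f).mono_measure ?_
    rw [← restrict_strip]
    exact Measure.restrict_mono_set _ (box_subset_strip T R)
  have hinv : MemLp (fun p : ℝ × ℝ => 1 * (w p.2)⁻¹) 2 (volume.restrict (period T ×ˢ Ioc 0 R)) :=
    restrict_box T R ▸ memLp_tensor (memLp_const 1) (hw.memLp_inv R)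
  refine (integrableOn_congr_fun (fun p hp => ?_) (measurableSet_box T R)).2
    (hf.integrable_mul hinv)
  rw [unweight_of_mem_strip hT f (box_subset_strip T R hp), Pi.mul_apply, one_mul, div_eq_mul_inv]

end Unweight

section Representation

variable {s T : ℝ} {hT : 0 < T} {U V : HT s T} {u v : GradientTrace T}

/-- The element `u = (w ∂_x U, w ∂_y U, U(·, 0))` of the Hilbert space of weighted gradients and
traces corresponds to the function `U ∈ 𝓗_T`, where `w² = d_s y^(1-2s)`. -/
structure Represents (hT : 0 < T) (U : HT s T) (u : GradientTrace T) : Prop where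
  gradX : u.fst =ᵐ[volume.restrict (strip T)] fun p => weight s p.2 * U.gradX p
  gradY : u.snd.fst =ᵐ[volume.restrict (strip T)] fun p => weight s p.2 * U.gradY p
  trace : u.snd.snd = equivL2Period hT U.trace

theorem ae_strip_iff {P : ℝ × ℝ → Prop} : (∀ᵐ p ∂volume.restrict (strip T), P p) ↔
    ∀ᵐ p ∂((volume : Measure ℝ).restrict (period T)).prod (volume.restrict (Ioi 0)), P p := by
  rw [restrict_strip]

theorem ae_eq_mul_iff_div_ae_eq {w : ℝ → ℝ} (hw : IsEnergyWeight w) {f P : ℝ × ℝ → ℝ} :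
    f =ᵐ[volume.restrict (strip T)] (fun p => w p.2 * P p) ↔
      (fun p => f p / w p.2) =ᵐ[volume.restrict (strip T)] P := by
  refine Filter.eventually_congr ?_
  filter_upwards [ae_restrict_mem (measurableSet_strip T)] with p hp
  rw [div_eq_iff (hw.pos p.2 hp.2).ne', mul_comm]

theorem Represents.mem_energySpace (h : Represents hT U u) (hw : IsEnergyWeight (weight s)) :
    u ∈ energySpace hw T := by
  refine (mem_energySpace_iff hw).2 (U.isGradientPair.congr ?_ ?_ ?_)
  · exact ((ae_eq_mul_iff_div_ae_eq hw).1 h.gradX).symm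
  · exact ((ae_eq_mul_iff_div_ae_eq hw).1 h.gradY).symm
  · exact h.trace ▸ (coeFn_equivL2Period hT U.trace).symm

theorem HT.memLp_weight_mul (U : HT s T) (hs0 : 0 < s) (hs1 : s < 1) {f : ℝ × ℝ → ℝ}
    (hf : AEStronglyMeasurable f (volume.restrict (strip T)))
    (hle : ∀ p, f p ^ 2 ≤ U.gradX p ^ 2 + U.gradY p ^ 2) :
    MemLp (fun p => weight s p.2 * f p) 2 (volume.restrict (strip T)) := by
  have hmeas : AEStronglyMeasurable (fun p => weight s p.2 * f p) (volume.restrict (strip T)) :=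
    ((isEnergyWeight_weight hs0 hs1).measurable.comp measurable_snd).aestronglyMeasurable.mul hf
  refine (memLp_two_iff_integrable_sq hmeas).2 ((U.finite_energy.const_mul (dConst s)).mono'
    (hmeas.pow 2) ?_)
  filter_upwards [ae_restrict_mem (measurableSet_strip T)] with p hp
  have hp2 : 0 < p.2 := hp.2
  have hd := dConst_pos hs0 hs1
  rw [Real.norm_of_nonneg (sq_nonneg _), mul_pow, weight_sq hs0 hs1 hp2, mul_assoc]
  gcongr
  exact hle p

theorem HT.exists_represents (U : HT s T) (hT : 0 < T) (hs0 : 0 < s) (hs1 : s < 1) :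
    ∃ u, Represents hT U u := by
  have hX := U.memLp_weight_mul hs0 hs1 U.gradX_meas fun p => le_add_of_nonneg_right (sq_nonneg _)
  have hY := U.memLp_weight_mul hs0 hs1 U.gradY_meas fun p => le_add_of_nonneg_left (sq_nonneg _)
  rw [restrict_strip] at hX hY
  refine ⟨WithLp.toLp 2 (hX.toLp, WithLp.toLp 2 (hY.toLp, equivL2Period hT U.trace)), ?_, ?_, rfl⟩
  · exact ae_strip_iff.2 hX.coeFn_toLp
  · exact ae_strip_iff.2 hY.coeFn_toLp

theorem integrableOn_energy_unweight (hT : 0 < T) (hs0 : 0 < s) (hs1 : s < 1) (f g : L2Strip T) :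
    IntegrableOn (fun p : ℝ × ℝ => p.2 ^ (1 - 2 * s) *
      (unweight hT (weight s) f p ^ 2 + unweight hT (weight s) g p ^ 2)) (strip T) := by
  have hfg : IntegrableOn (fun p => (dConst s)⁻¹ * (f p ^ 2 + g p ^ 2)) (strip T) := by
    rw [IntegrableOn, restrict_strip]
    exact ((Lp.memLp f).integrable_sq.add (Lp.memLp g).integrable_sq).const_mul _
  refine hfg.congr_fun (fun p hp => ?_) (measurableSet_strip T)
  have hp2 : 0 < p.2 := hp.2
  have hd := (dConst_pos hs0 hs1).ne'
  have hy := (Real.rpow_pos_of_pos hp2 (1 - 2 * s)).ne'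
  simp only [unweight_of_mem_strip hT _ hp, div_pow, weight_sq hs0 hs1 hp2]
  field_simp

theorem exists_HT_represents (hT : 0 < T) (hs0 : 0 < s) (hs1 : s < 1)
    (hu : u ∈ energySpace (isEnergyWeight_weight hs0 hs1) T) :
    ∃ U : HT s T, Represents hT U u := by
  have hw := isEnergyWeight_weight hs0 hs1
  have hmeas (f : L2Strip T) : StronglyMeasurable (unweight hT (weight s) f) :=
    stronglyMeasurable_unweight hT hw.measurable (Lp.stronglyMeasurable f)
  let b : L2T T := (equivL2Period hT).symm u.snd.snd
  have htrace : equivL2Period hT b = u.snd.snd := LinearEquiv.apply_symm_apply _ _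
  have hpair : IsGradientPair T (unweight hT (weight s) u.fst) (unweight hT (weight s) u.snd.fst)
      (b : ℝ →ₘ[(volume : Measure ℝ)] ℝ) :=
    ((mem_energySpace_iff _).1 hu).congr (unweight_ae_eq hT _ _).symm
      (unweight_ae_eq hT _ _).symm (htrace ▸ coeFn_equivL2Period hT b)
  obtain ⟨U, hX, hY, hb⟩ := exists_HT_of_isGradientPair hT hpair (hmeas _).aestronglyMeasurable
    (hmeas _) (unweight_add hT _) (unweight_add hT _) (integrableOn_unweight hT hw _)
    (integrableOn_energy_unweight hT hs0 hs1 _ _)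
  refine ⟨U, (ae_eq_mul_iff_div_ae_eq hw).2 ?_, (ae_eq_mul_iff_div_ae_eq hw).2 ?_, ?_⟩
  · exact hX ▸ (unweight_ae_eq hT _ _).symm
  · exact hY ▸ (unweight_ae_eq hT _ _).symm
  · rw [hb, htrace]

theorem Represents.energy_eq (hu : Represents hT U u) (hv : Represents hT V v) (hs0 : 0 < s)
    (hs1 : s < 1) :
    dConst s * (∫ p in strip T, p.2 ^ (1 - 2 * s) *
      (U.gradX p * V.gradX p + U.gradY p * V.gradY p)) =
      inner ℝ u.fst v.fst + inner ℝ u.snd.fst v.snd.fst := by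
  rw [inner_eq_integral_mul, inner_eq_integral_mul,
    ← integral_add ((Lp.memLp _).integrable_mul (Lp.memLp _))
      ((Lp.memLp _).integrable_mul (Lp.memLp _)),
    ← integral_const_mul, restrict_strip]
  refine integral_congr_ae (ae_strip_iff.1 ?_)
  filter_upwards [hu.gradX, hu.gradY, hv.gradX, hv.gradY, ae_restrict_mem (measurableSet_strip T)]
    with p huX huY hvX hvY hp
  rw [huX, huY, hvX, hvY, ← mul_assoc, ← weight_sq hs0 hs1 (show 0 < p.2 from hp.2)]
  ring

theorem Represents.potential_eq {k : ℝ → ℝ}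
    (hk : MemLp (fun x => k x - 1) ⊤ (volume.restrict (period T)))
    (hu : Represents hT U u) (hv : Represents hT V v) :
    ∫ x in period T, k x * (U.trace : ℝ →ₘ[(volume : Measure ℝ)] ℝ) x *
      (V.trace : ℝ →ₘ[(volume : Measure ℝ)] ℝ) x =
      inner ℝ u.snd.snd v.snd.snd + inner ℝ (mulL hk u.snd.snd) v.snd.snd := by
  rw [← inner_add_left, inner_eq_integral_mul, hu.trace, hv.trace]
  refine integral_congr_ae ?_
  filter_upwards [coeFn_equivL2Period hT U.trace, coeFn_equivL2Period hT V.trace,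
    coeFn_mulL hk (equivL2Period hT U.trace),
    Lp.coeFn_add (equivL2Period hT U.trace) (mulL hk (equivL2Period hT U.trace))]
    with x hxU hxV hmul hadd
  rw [hadd, Pi.add_apply, hmul, hxU, hxV]
  ring

-- The inner product of the energy space contains `∫ U(x, 0) V(x, 0) dx`, which turns the potential
-- `k` into the multiplier `k - 1`.
theorem Represents.form_eq_inner {k : ℝ → ℝ}
    (hk : MemLp (fun x => k x - 1) ⊤ (volume.restrict (period T)))
    (hu : Represents hT U u) (hv : Represents hT V v) (hs0 : 0 < s) (hs1 : s < 1) :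
    form k U V = inner ℝ u v + inner ℝ (mulL hk u.snd.snd) v.snd.snd := by
  rw [form, hu.energy_eq hv hs0 hs1, hu.potential_eq hk hv, WithLp.prod_inner_apply,
    WithLp.prod_inner_apply, ← add_assoc, ← add_assoc]
  rfl

end Representation

theorem isWeakSolution_iff {s T : ℝ} (hs0 : 0 < s) (hs1 : s < 1) (hT : 0 < T) {k : ℝ → ℝ}
    (hk : MemLp (fun x => k x - 1) ⊤ (volume.restrict (period T))) (g f : L2T T) :
    IsWeakSolution s T k g f ↔
      IsVariationalSolution (H := energySpace (isEnergyWeight_weight hs0 hs1) T) (traceL _ T)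
        (mulL hk) (equivL2Period hT g) (equivL2Period hT f) := by
  have hw := isEnergyWeight_weight hs0 hs1
  constructor
  · rintro ⟨U, rfl, hU⟩
    obtain ⟨u, hu⟩ := U.exists_represents hT hs0 hs1
    refine ⟨⟨u, hu.mem_energySpace hw⟩, hu.trace, fun v => ?_⟩
    obtain ⟨V, hV⟩ := exists_HT_represents hT hs0 hs1 v.2
    calc _ = form k U V := (hu.form_eq_inner hk hV hs0 hs1).symm
      _ = _ := by rw [hU, pairing_eq_inner hT, ← hV.trace]; rfl
  · rintro ⟨u, huf, hsol⟩
    obtain ⟨U, hU⟩ := exists_HT_represents hT hs0 hs1 u.2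
    refine ⟨U, (equivL2Period hT).injective (hU.trace.symm.trans huf), fun V => ?_⟩
    obtain ⟨v, hv⟩ := V.exists_represents hT hs0 hs1
    rw [hU.form_eq_inner hk hv hs0 hs1, pairing_eq_inner hT, ← hv.trace]
    exact hsol ⟨v, hv.mem_energySpace hw⟩

end PeriodicFracLap

open PeriodicFracLap in
theorem theorem2p2 (s T : ℝ) (hs0 : 0 < s) (hs1 : s < 1) (hT : 0 < T)
    (k : ℝ → ℝ) (hk_meas : AEMeasurable k) (hk_per : Function.Periodic k T)
    (hk_bdd : ∃ M : ℝ, ∀ x, |k x| ≤ M) :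
    Xor (∀ g : PeriodicFracLap.L2T T, ∃! u : PeriodicFracLap.L2T T,
            PeriodicFracLap.IsWeakSolution s T k g u)
         (∃ u : PeriodicFracLap.L2T T, u ≠ 0 ∧ PeriodicFracLap.IsWeakSolution s T k 0 u) ∧
    ∃ N : Submodule ℝ (PeriodicFracLap.L2T T),
      (∀ v : PeriodicFracLap.L2T T, v ∈ N ↔ PeriodicFracLap.IsWeakSolution s T k 0 v) ∧
      FiniteDimensional ℝ N ∧
      ∀ g : PeriodicFracLap.L2T T,
        (∃ u : PeriodicFracLap.L2T T, PeriodicFracLap.IsWeakSolution s T k g u) ↔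
          ∀ v ∈ N, PeriodicFracLap.pairing g v = 0 := by
  obtain ⟨M, hM⟩ := hk_bdd
  have hk : MemLp (fun x => k x - 1) ⊤ (volume.restrict (period T)) :=
    (memLp_top_of_bound hk_meas.restrict.aestronglyMeasurable M (.of_forall hM)).sub (memLp_const 1)
  have hw : IsEnergyWeight (weight s) := isEnergyWeight_weight hs0 hs1
  simp only [pairing_eq_inner hT]
  exact fredholm_alternative_of_linearEquiv (H := energySpace hw T) (t := traceL hw T)
    (M := mulL hk) (isCompactOperator_traceL hw hT) (isSymmetric_mulL hk) (equivL2Period hT)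
    (isWeakSolution_iff hs0 hs1 hT hk)
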